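/- A concurrent game structure (CGS) under imperfect information consists of finite non-empty sets $Ag=\{1,\dots,k\}$ (agents), $S$ (states), $\Pi$ (atomic propositions), $Act$ (actions), a labelling $\pi:S\to\mathcal P(\Pi)$, an equivalence relation $\sim_i$ on $S$ for each agent $i$, a map $d:Ag\times S\to\mathcal P(Act)\setminus\{\emptyset\}$ with $d(i,s)=d(i,s')$ whenever $s\sim_i s'$, and a partial transition function from $S\times Act^k$ to $S$ that is defined at $(s,(a_1,\dots,a_k))$ if and only if $a_i\in d(i,s)$ for all $i$. A perfect recall strategy of agent $i$ is a function $\sigma:S^+\to Act$ with $\sigma(\alpha s)\in d(i,s)$ for all $\alpha\in S^*$, $s\in S$, and $\sigma(\alpha)=\sigma(\alpha')$ whenever $\alpha,\alpha'$ have the same length and are componentwise $\sim_i$-equivalent; a strategy $\sigma_A$ of a team $A\subseteq Ag$ is a family $(\sigma_i)_{i\in A}$ of such strategies. Let $out(s,\sigma_A)$ be the set of infinite sequences $s_0s_1s_2\cdots$ with $s_0=s$ such that for each $j\ge 0$ some action tuple $a$ with $a_i=\sigma_i(s_0\cdots s_j)$ for $i\in A$ and $a_i\in d(i,s_j)$ for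 $i\notin A$ leads from $s_j$ to $s_{j+1}$. The formulas of ATL are built from atomic propositions by $\neg$, $\wedge$, $\langle\langle A\rangle\rangle\bigcirc\varphi$, $\langle\langle A\rangle\rangle\Box\varphi$ and $\langle\langle A\rangle\rangle\varphi U\psi$ with $\emptyset\ne A\subseteq Ag$. The relation $(\mathcal G,s)\models_{iR}\varphi$ is defined as usual for atoms and Boolean connectives, and $(\mathcal G,s)\models_{iR}\langle\langle A\rangle\rangle\theta$ holds if there is a perfect recall strategy $\sigma_A$ such that every sequence in $out(s,\sigma_A)$ satisfies $\theta$, where $\bigcirc$, $\Box$, $U$ mean next, globally and until. A deterministic Turing machine $M=(Q,\Sigma,q_0,B,\delta)$ has finite sets $Q$ of states and $\Sigma$ of tape symbols, an initial state $q_0$, a blank symbol $B\in\Sigma$, a partial transition function $\delta$ from $Q\times\Sigma$ to $Q\times\Sigma\times\{L,R\}$, and a tape that is infinite to the right only. It halts on the empty word if, started in $q_0$ on the leftmost cell of the blank tape, it reaches a configuration in which $\delta$ is undefined or requires a left move from the leftmost cell. Theorem. (1) The model checking problem for ATL under the imperfect information, perfect recall semantics $\models_{iR}$ is undecidable: there is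 no algorithm that, given (finite descriptions of) a CGS $\mathcal G$ under imperfect information, a state $s$ of $\mathcal G$ and an ATL formula $\varphi$, decides whether $(\mathcal G,s)\models_{iR}\varphi$. (2) Moreover, there is an algorithm that transforms (the finite description of) every deterministic Turing machine $M$ into (the finite description of) a CGS $\mathcal G$ under imperfect information with agents $\{1,2,3\}$, a state $s_{init}$ of $\mathcal G$ and a formula $\langle\langle\{1,2\}\rangle\rangle\Box\,ok$ with an atomic proposition $ok$, such that $M$ does not halt on the empty word if and only if $(\mathcal G,s_{init})\models_{iR}\langle\langle\{1,2\}\rangle\rangle\Box\,ok$. -/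

import Mathlib

namespace ATLiR

/-- Syntax of `ATL` over a set `Ag` of agents and a set `P` of atomic propositions:
atoms, negation, conjunction, `⟨⟨A⟩⟩ ◯ φ`, `⟨⟨A⟩⟩ □ φ` and `⟨⟨A⟩⟩ φ U ψ`, for non-empty `A`. -/
inductive Formula (Ag P : Type) : Type
  | atom (p : P) : Formula Ag P
  | neg (φ : Formula Ag P) : Formula Ag P
  | conj (φ ψ : Formula Ag P) : Formula Ag P
  | next (A : Finset Ag) (hA : A.Nonempty) (φ : Formula Ag P) : Formula Ag P
  | globally (A : Finset Ag) (hA : A.Nonempty) (φ : Formula Ag P) : Formula Ag P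
  | untl (A : Finset Ag) (hA : A.Nonempty) (φ ψ : Formula Ag P) : Formula Ag P

/-- A concurrent game structure under imperfect information with agents `Ag`, states `S`,
atomic propositions `P` and actions `Act`. -/
structure CGS (Ag S P Act : Type) where
  /-- the state-labelling function `π` -/
  label : S → Set P
  /-- the observation equivalences `∼ᵢ` -/
  obs : Ag → Setoid S
  /-- the actions available to an agent at a state -/
  avail : Ag → S → Set Act
  avail_nonempty : ∀ i s, (avail i s).Nonempty
  avail_obs : ∀ i s s', obs i s s' → avail i s = avail i s'
  /-- the partial transition function on action tuples -/
  trans : S → (Ag → Act) → Option S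
  trans_isSome : ∀ s a, (trans s a).isSome ↔ ∀ i, a i ∈ avail i s

namespace CGS

variable {Ag S P Act : Type}

/-- A perfect recall strategy of agent `i`. A non-empty sequence of states is given as
a pair `α`, `s`: it is the sequence `α` followed by the last state `s`. -/
structure Strategy (G : CGS Ag S P Act) (i : Ag) where
  act : List S → S → Act
  act_avail : ∀ α s, act α s ∈ G.avail i s
  act_obs : ∀ α α' s s', List.Forall₂ (fun t t' => G.obs i t t') α α' → G.obs i s s' →
    act α s = act α' s'

/-- A perfect recall strategy for a team `A` of agents. -/
abbrev TeamStrategy (G : CGS Ag S P Act) (A : Finset Ag) : Type :=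
  (i : {i : Ag // i ∈ A}) → G.Strategy i.1

/-- The action tuple `a` is allowed by the team strategy `σ` after the history `α s`. -/
def Allowed (G : CGS Ag S P Act) {A : Finset Ag} (σ : G.TeamStrategy A)
    (α : List S) (s : S) (a : Ag → Act) : Prop :=
  (∀ i, i ∉ A → a i ∈ G.avail i s) ∧ ∀ i : {i : Ag // i ∈ A}, a i.1 = (σ i).act α s

/-- The infinite sequences of states that start in `s` and are consistent with `σ`. -/
def out (G : CGS Ag S P Act) {A : Finset Ag} (s : S) (σ : G.TeamStrategy A) : Set (ℕ → S) :=
  {l | l 0 = s ∧ ∀ j, ∃ a, G.Allowed σ ((List.range j).map l) (l j) a ∧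
    G.trans (l j) a = some (l (j + 1))}

/-- The imperfect information, perfect recall semantics `(G, s) ⊨ φ` (de dicto: the outcomes
are those that start in the actual state `s`). -/
def Sat (G : CGS Ag S P Act) : S → Formula Ag P → Prop
  | s, .atom p => p ∈ G.label s
  | s, .neg φ => ¬ G.Sat s φ
  | s, .conj φ ψ => G.Sat s φ ∧ G.Sat s ψ
  | s, .next A _ φ => ∃ σ : G.TeamStrategy A, ∀ l ∈ G.out s σ, G.Sat (l 1) φ
  | s, .globally A _ φ => ∃ σ : G.TeamStrategy A, ∀ l ∈ G.out s σ, ∀ j, G.Sat (l j) φ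
  | s, .untl A _ φ ψ => ∃ σ : G.TeamStrategy A, ∀ l ∈ G.out s σ,
      ∃ j, G.Sat (l j) ψ ∧ ∀ k < j, G.Sat (l k) φ

end CGS

/-- An input of the model checking problem: a finite game structure, a state and a formula.
The finite non-empty sets of agents, states, propositions and actions are initial segments
of the natural numbers. -/
structure Instance where
  numAgents : ℕ
  numStates : ℕ
  numProps : ℕ
  numActs : ℕ
  agents_pos : 0 < numAgents
  states_pos : 0 < numStates
  props_pos : 0 < numProps
  acts_pos : 0 < numActs
  G : CGS (Fin numAgents) (Fin numStates) (Fin numProps) (Fin numActs)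
  state : Fin numStates
  formula : Formula (Fin numAgents) (Fin numProps)

/-- The question asked about an input. -/
def Instance.Holds (I : Instance) : Prop := I.G.Sat I.state I.formula

/-- Prefix notation for formulas. A coalition is written as its characteristic 0-1 word,
which has one letter for each of the `k` agents. -/
def Formula.code {k p : ℕ} : Formula (Fin k) (Fin p) → List ℕ
  | .atom q => [0, (q : ℕ)]
  | .neg φ => 1 :: φ.code
  | .conj φ ψ => 2 :: (φ.code ++ ψ.code)
  | .next A _ φ => 3 :: (List.ofFn (fun i => if i ∈ A then 1 else 0) ++ φ.code)
  | .globally A _ φ => 4 :: (List.ofFn (fun i => if i ∈ A then 1 else 0) ++ φ.code)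
  | .untl A _ φ ψ =>
      5 :: (List.ofFn (fun i => if i ∈ A then 1 else 0) ++ (φ.code ++ ψ.code))

/-- Finite descriptions of inputs: the numbers of agents, states, propositions and actions;
the tables of the labelling, of the observation equivalences, of the available actions and
of the transition function; the state; the formula. -/
abbrev InstanceCode : Type :=
  (ℕ × ℕ × ℕ × ℕ) × List (List Bool) × List (List (List Bool)) × List (List (List Bool)) ×
    List (List (Option ℕ)) × ℕ × List ℕ

open Classical in
/-- The description of an input. Every table is complete. In the row of a state, the table of
the transition function lists the action tuples `a` in the order of the numbers
`∑ i, a i * (numActs) ^ i`. -/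
noncomputable def Instance.code (I : Instance) : InstanceCode :=
  ((I.numAgents, I.numStates, I.numProps, I.numActs),
    List.ofFn (fun s => List.ofFn fun p => decide (p ∈ I.G.label s)),
    List.ofFn (fun i => List.ofFn fun s => List.ofFn fun s' => decide (I.G.obs i s s')),
    List.ofFn (fun i => List.ofFn fun s => List.ofFn fun a => decide (a ∈ I.G.avail i s)),
    List.ofFn (fun s => List.ofFn fun c : Fin (I.numActs ^ I.numAgents) =>
      (I.G.trans s (finFunctionFinEquiv.symm c)).map Fin.val),
    (I.state : ℕ), I.formula.code)

/-- Decidability of the model checking problem: some algorithm gives the correct answer on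
the description of every input. -/
def ModelCheckingDecidable : Prop :=
  ∃ f : InstanceCode → Bool, Computable f ∧ ∀ I : Instance, f I.code = true ↔ I.Holds

/-- Deterministic Turing machines with states `Q`, tape alphabet `A` and a tape that is
infinite to the right only. -/
structure TM (Q A : Type) where
  start : Q
  blank : A
  δ : Q → A → Option (Q × A × Turing.Dir)

namespace TM

variable {Q A : Type}

/-- Configurations: state, head position and tape content; the leftmost cell has number `0`. -/
structure Cfg (Q A : Type) where
  state : Q
  head : ℕ
  tape : ℕ → A

/-- The initial configuration on the empty word. -/
def init (M : TM Q A) : Cfg Q A := ⟨M.start, 0, fun _ => M.blank⟩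

/-- One step. There is no next configuration if `δ` is undefined or if the head would move
to the left of the leftmost cell. -/
def step (M : TM Q A) (c : Cfg Q A) : Option (Cfg Q A) :=
  match M.δ c.state (c.tape c.head), c.head with
  | none, _ => none
  | some (q, b, .right), h => some ⟨q, h + 1, Function.update c.tape h b⟩
  | some (_, _, .left), 0 => none
  | some (q, b, .left), h + 1 => some ⟨q, h, Function.update c.tape (h + 1) b⟩

/-- `M` halts on the empty word. -/
def Halts (M : TM Q A) : Prop :=
  ∃ c, Relation.ReflTransGen (fun c c' => M.step c = some c') M.init c ∧ M.step c = none

/-- Finite descriptions of machines: the numbers of states and of symbols, the initial state,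
the blank symbol and the table of `δ` (`true` stands for a move to the right). -/
abbrev Code : Type := (ℕ × ℕ) × ℕ × ℕ × List (List (Option (ℕ × ℕ × Bool)))

/-- The description of a machine. -/
def code {n m : ℕ} (M : TM (Fin n) (Fin m)) : Code :=
  ((n, m), (M.start : ℕ), (M.blank : ℕ),
    List.ofFn (fun q => List.ofFn fun a => (M.δ q a).map fun t =>
      ((t.1 : ℕ), (t.2.1 : ℕ), match t.2.2 with
        | .left => false
        | .right => true)))

end TM

end ATLiR

namespace ATLiR

/-- `f` assigns one of `W` tiles to every position `(x, n)`. For `x ≤ n`, consecutive tiles of a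
column `x` are related by `V` and neighbouring tiles of a row `n` by `H`; the tile at the bottom
of column `0` may follow `0`, the tiles at the bottom of the other columns may follow `1`. -/
structure IsTiling (W : ℕ) (V H : ℕ → ℕ → Bool) (f : ℕ → ℕ → ℕ) : Prop where
  lt : ∀ x n, f x n < W
  corner : V 0 (f 0 0) = true
  diag : ∀ x, V 1 (f (x + 1) (x + 1)) = true
  vert : ∀ x n, x ≤ n → V (f x n) (f x (n + 1)) = true
  horiz : ∀ x n, x < n → H (f x n) (f (x + 1) n) = true

/-- A sequence in which every entry is given as a function of all the entries before it. -/
theorem exists_seq_of_history {S : Type} (s : S) (F : ℕ → List S → S → S) :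
    ∃ l : ℕ → S, l 0 = s ∧ ∀ j, l (j + 1) = F j ((List.range j).map l) (l j) := by
  let h : ℕ → List S × S :=
    fun j => Nat.rec ([], s) (fun j p => (p.1 ++ [p.2], F j p.1 p.2)) j
  have h1 : ∀ j, (h j).1 = (List.range j).map (fun j => (h j).2) := by
    intro j
    induction j with
    | zero => rfl
    | succ j ih => rw [List.range_succ, List.map_append, ← ih]; rfl
  refine ⟨fun j => (h j).2, rfl, fun j => ?_⟩
  rw [← h1]

namespace TilingGame

/-- The transition function. The state `5 * v + 0` is the waiting state; in `5 * v + 1` both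
players fill the same column, and `v` is the last tile; in `2` and `3` they fill neighbouring
columns, where the right one is still empty in `2`; `4` is the losing state. -/
def next (V H : ℕ → ℕ → Bool) (s a b e : ℕ) : ℕ :=
  if s % 5 = 0 then if e = 0 then 5 else if e = 1 then s + 1 else 2
  else if s % 5 = 1 then if a = b ∧ V (s / 5) a = true then 5 * a + 1 else 4
  else if s % 5 = 2 then 3
  else if s % 5 = 3 then if H a b = true then 3 else 4
  else 4

theorem next_lt {W : ℕ} (hW : 3 ≤ W) (V H : ℕ → ℕ → Bool) {s a b e : ℕ} (hs : s < 5 * W)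
    (ha : a < W) : next V H s a b e < 5 * W := by
  unfold next
  split_ifs <;> omega

/-- Whether agent `i` sees that its column has not been fixed yet. -/
def waits (i s : ℕ) : Bool := decide (s % 5 = 0 ∨ i = 1 ∧ s % 5 = 2)

/-- The game in which the agents `0` and `1` have to describe a tiling. -/
def game (W : ℕ) (hW : 3 ≤ W) (V H : ℕ → ℕ → Bool) :
    CGS (Fin 3) (Fin (5 * W)) (Fin 1) (Fin W) where
  label s := {_p | s.val % 5 ≠ 4}
  obs i := Setoid.ker fun s => waits i.val s.val
  avail _ _ := Set.univ
  avail_nonempty _ _ := ⟨⟨0, by omega⟩, trivial⟩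
  avail_obs _ _ _ _ := rfl
  trans s a := some ⟨next V H s (a 0) (a 1) (a 2), next_lt hW V H s.2 (a 0).2⟩
  trans_isSome _ _ := by simp

variable {W : ℕ} {hW : 3 ≤ W} {V H : ℕ → ℕ → Bool}

theorem game_obs {i : Fin 3} {s t : Fin (5 * W)} :
    (game W hW V H).obs i s t ↔ waits i s = waits i t := Iff.rfl

theorem countP_waits_eq {i : Fin 3} {α α' : List (Fin (5 * W))}
    (h : List.Forall₂ (fun t t' => (game W hW V H).obs i t t') α α') :
    α.countP (fun s : Fin (5 * W) => waits i s) = α'.countP (fun s : Fin (5 * W) => waits i s) := by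
  induction h with
  | nil => rfl
  | cons h _ ih => rw [List.countP_cons, List.countP_cons, ih, game_obs.1 h]

/-- The strategy of agent `i` that describes the tiling `f`. -/
def tilingStrategy {f : ℕ → ℕ → ℕ} (hf : ∀ x n, f x n < W) (i : Fin 3) :
    (game W hW V H).Strategy i where
  act α s := ⟨f ((α ++ [s]).countP (fun s : Fin (5 * W) => waits i s) - 1) (α.length - 1), hf _ _⟩
  act_avail _ _ := trivial
  act_obs α α' s s' h hs := by
    rw [List.countP_append, List.countP_append, countP_waits_eq h,
      countP_waits_eq (List.Forall₂.cons hs List.Forall₂.nil), h.length_eq]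

/-- What is known about a play against the strategies that describe `f`: here `j` is the length
of the history, `s` the last state, and `c₀`, `c₁` are the numbers of states in which the agents
had to wait. -/
def PlayInv (f : ℕ → ℕ → ℕ) (j s c₀ c₁ : ℕ) : Prop :=
  (s = 5 * min j 1 ∧ c₀ = j + 1 ∧ c₁ = j + 1) ∨
  (∃ x < j, c₀ = x + 1 ∧ c₁ = x + 1 ∧
    s = 5 * (if j = x + 1 then min x 1 else f x (j - 2)) + 1) ∨
  (s = 2 ∧ 1 ≤ j ∧ c₀ = j ∧ c₁ = j + 1) ∨
  ∃ x, x + 2 ≤ j ∧ s = 3 ∧ c₀ = x + 1 ∧ c₁ = x + 2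

theorem PlayInv.succ {f : ℕ → ℕ → ℕ} (hf : IsTiling W V H f) {j s c₀ c₁ e t : ℕ}
    (h : PlayInv f j s c₀ c₁)
    (ht : t = next V H s (f (c₀ - 1) (j - 1)) (f (c₁ - 1) (j - 1)) e) :
    PlayInv f (j + 1) t (c₀ + if waits 0 t = true then 1 else 0)
      (c₁ + if waits 1 t = true then 1 else 0) := by
  rcases h with ⟨rfl, rfl, rfl⟩ | ⟨x, hx, rfl, rfl, rfl⟩ | ⟨rfl, hj, hc, rfl⟩ |
    ⟨x, hx, rfl, rfl, rfl⟩
  · rw [next, if_pos (by omega)] at ht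
    split_ifs at ht
    · left
      subst ht
      simp [waits]
    · right; left
      subst ht
      refine ⟨j, by omega, ?_, ?_, ?_⟩
      · simp [waits, Nat.add_mod]
      · simp [waits, Nat.add_mod]
      · simp
    · right; right; left
      subst ht
      simp [waits]
  · rw [next, if_neg (by omega), if_pos (by omega)] at ht
    have hV : V (if j = x + 1 then min x 1 else f x (j - 2)) (f x (j - 1)) = true := by
      split_ifs with h
      · subst h
        rcases x with _ | x
        · exact hf.corner
        · simpa using hf.diag x
      · obtain ⟨n, rfl⟩ : ∃ n, j = n + 2 := ⟨j - 2, by omega⟩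
        exact hf.vert x n (by omega)
    have hd : (5 * (if j = x + 1 then min x 1 else f x (j - 2)) + 1) / 5 =
      if j = x + 1 then min x 1 else f x (j - 2) := by omega
    rw [hd, if_pos ⟨rfl, hV⟩] at ht
    right; left
    subst ht
    refine ⟨x, by omega, ?_, ?_, ?_⟩
    · simp [waits, Nat.add_mod]
    · simp [waits, Nat.add_mod]
    · rw [if_neg (by omega)]; rfl
  · right; right; right
    obtain ⟨x, rfl⟩ : ∃ x, j = x + 1 := ⟨j - 1, by omega⟩
    subst hc
    simp only [next] at ht
    norm_num at ht
    subst ht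
    exact ⟨x, by omega, rfl, by simp [waits], by simp [waits]⟩
  · right; right; right
    have hH := hf.horiz x (j - 1) (by omega)
    simp only [next] at ht
    norm_num [hH] at ht
    subst ht
    exact ⟨x, by omega, rfl, by simp [waits], by simp [waits]⟩

theorem PlayInv.ne_lost {f : ℕ → ℕ → ℕ} {j s c₀ c₁ : ℕ} (h : PlayInv f j s c₀ c₁) :
    s % 5 ≠ 4 := by
  rcases h with ⟨rfl, -⟩ | ⟨x, -, -, -, rfl⟩ | ⟨rfl, -⟩ | ⟨x, -, rfl, -⟩ <;> omega

theorem sat_of_isTiling {f : ℕ → ℕ → ℕ} (hf : IsTiling W V H f) :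
    (game W hW V H).Sat ⟨0, by omega⟩ (.globally {0, 1} (by simp) (.atom 0)) := by
  refine ⟨fun i => tilingStrategy hf.lt i.1, ?_⟩
  rintro l ⟨h0, hl⟩ j
  let c : Fin 3 → ℕ → ℕ := fun i j =>
    ((List.range j).map l ++ [l j]).countP (fun s : Fin (5 * W) => waits i s)
  have hc : ∀ i j, c i (j + 1) = c i j + if waits i (l (j + 1)) = true then 1 else 0 := by
    intro i j
    simp only [c, List.range_succ, List.map_append, List.countP_append, List.map_cons,
      List.map_nil, List.countP_cons, List.countP_nil]
    omega
  have inv : ∀ j, PlayInv f j (l j) (c 0 j) (c 1 j) := by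
    intro j
    induction j with
    | zero => left; simp [c, h0, waits]
    | succ j ih =>
      obtain ⟨a, ⟨-, ha⟩, ht⟩ := hl j
      have ha0 := ha ⟨0, by simp⟩
      have ha1 := ha ⟨1, by simp⟩
      rw [hc, hc]
      refine ih.succ hf (e := a 2) ?_
      have := congrArg Fin.val (Option.some.inj ht)
      rw [← this]
      simp only [ha0, ha1, tilingStrategy, List.length_map, List.length_range, c]
  exact (inv j).ne_lost

/-- The action of a strategy depends only on how long the agent had to wait, and on the time
that has passed since. -/
theorem act_eq_of_waits {i : Fin 3} (σ : (game W hW V H).Strategy i) {l : ℕ → Fin (5 * W)}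
    {c k : ℕ} {r t : Fin (5 * W)} (hr : waits i r = true) (ht : waits i t = false)
    (h1 : ∀ j < c, waits i (l j) = true)
    (h2 : ∀ j, c ≤ j → j ≤ c + k → waits i (l j) = false) :
    σ.act ((List.range (c + k)).map l) (l (c + k)) =
      σ.act (List.replicate c r ++ List.replicate k t) t := by
  refine σ.act_obs _ _ _ _ ?_ (game_obs.2 ((h2 _ (by omega) le_rfl).trans ht.symm))
  rw [List.forall₂_iff_get]
  refine ⟨by simp, fun j hj _ => game_obs.2 ?_⟩
  simp only [List.length_map, List.length_range] at hj
  simp only [List.get_eq_getElem, List.getElem_map, List.getElem_range, List.getElem_append,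
    List.length_replicate, List.getElem_replicate]
  split_ifs with h
  · rw [h1 _ h, hr]
  · rw [h2 _ (by omega) (by omega), ht]

theorem exists_play (σ : (game W hW V H).TeamStrategy {0, 1}) (s : Fin (5 * W)) (e : ℕ → Fin W) :
    ∃ l ∈ (game W hW V H).out s σ, ∀ j, (l (j + 1)).val = next V H (l j)
      ((σ ⟨0, by simp⟩).act ((List.range j).map l) (l j))
      ((σ ⟨1, by simp⟩).act ((List.range j).map l) (l j)) (e j) := by
  obtain ⟨l, h0, hl⟩ := exists_seq_of_history s fun j α s =>
    (⟨next V H s ((σ ⟨0, by simp⟩).act α s) ((σ ⟨1, by simp⟩).act α s) (e j),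
      next_lt hW V H s.2 (Fin.is_lt _)⟩ : Fin (5 * W))
  refine ⟨l, ⟨h0, fun j => ⟨![(σ ⟨0, by simp⟩).act ((List.range j).map l) (l j),
      (σ ⟨1, by simp⟩).act ((List.range j).map l) (l j), e j], ⟨fun _ _ => trivial, ?_⟩, ?_⟩⟩, ?_⟩
  · rintro ⟨i, hi⟩
    have hi' : i = 0 ∨ i = 1 := by simpa using hi
    rcases hi' with rfl | rfl <;> rfl
  · rw [hl]; rfl
  · intro j; rw [hl]

theorem isTiling_of_sat
    (h : (game W hW V H).Sat ⟨0, by omega⟩ (.globally {0, 1} (by simp) (.atom 0))) :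
    ∃ f, IsTiling W V H f := by
  obtain ⟨σ, hσ⟩ := h
  have hok : ∀ l ∈ (game W hW V H).out ⟨0, by omega⟩ σ, ∀ j, (l j).val % 5 ≠ 4 :=
    fun l hl j => hσ l hl j
  let r : Fin (5 * W) := ⟨0, by omega⟩
  let t : Fin (5 * W) := ⟨4, by omega⟩
  let g : {i : Fin 3 // i ∈ ({0, 1} : Finset (Fin 3))} → ℕ → ℕ → Fin W := fun i x k =>
    (σ i).act (List.replicate (x + 1) r ++ List.replicate k t) t
  have hr : ∀ i, waits i r = true := fun i => by simp [waits, r]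
  have ht : ∀ i, waits i t = false := fun i => by simp [waits, t]
  have hwait : ∀ (e : ℕ → Fin W) (x : ℕ) (l : ℕ → Fin (5 * W)), l 0 = ⟨0, by omega⟩ →
      (∀ j, (l (j + 1)).val = next V H (l j)
        ((σ ⟨0, by simp⟩).act ((List.range j).map l) (l j))
        ((σ ⟨1, by simp⟩).act ((List.range j).map l) (l j)) (e j)) →
      (∀ j < x, (e j).val = 0) → ∀ j ≤ x, (l j).val = 5 * min j 1 := by
    intro e x l h0 hl he j hj
    induction j with
    | zero => simp [h0]
    | succ j ih =>
      rw [hl, next, if_pos (by rw [ih (by omega)]; omega), if_pos (he j (by omega))]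
      omega
  have hsame : ∀ x k, g ⟨0, by simp⟩ x k = g ⟨1, by simp⟩ x k ∧
      V (if k = 0 then min x 1 else g ⟨0, by simp⟩ x (k - 1)) (g ⟨0, by simp⟩ x k) = true := by
    intro x
    obtain ⟨l, hlo, hl⟩ := exists_play σ ⟨0, by omega⟩
      (fun j => if j < x then ⟨0, by omega⟩ else ⟨1, by omega⟩)
    have hw := hwait _ x l hlo.1 hl (fun j hj => by simp [hj])
    have key : ∀ k, (∀ k' ≤ k, (l (x + 1 + k')).val % 5 = 1) ∧
        (l (x + 1 + k)).val / 5 = if k = 0 then min x 1 else g ⟨0, by simp⟩ x (k - 1) := by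
      intro k
      induction k with
      | zero =>
        have : (l (x + 1)).val = 5 * min x 1 + 1 := by
          rw [hl, next, if_pos (by rw [hw x le_rfl]; omega)]
          simp [hw x le_rfl]
        refine ⟨fun k' hk' => ?_, ?_⟩
        · obtain rfl : k' = 0 := by omega
          rw [add_zero, this]; omega
        · rw [add_zero, this, if_pos rfl]; omega
      | succ k ih =>
        have hw2 : ∀ i : Fin 3, ∀ j, x + 1 ≤ j → j ≤ x + 1 + k → waits i (l j) = false := by
          intro i j h1 h2
          obtain ⟨k', rfl⟩ := Nat.exists_eq_add_of_le h1
          simp [waits, ih.1 k' (by omega)]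
        have hw1 : ∀ i : Fin 3, ∀ j < x + 1, waits i (l j) = true := by
          intro i j hj
          simp [waits, hw j (by omega)]
        have hlk := hl (x + 1 + k)
        rw [act_eq_of_waits _ (hr 0) (ht 0) (hw1 0) (hw2 0),
          act_eq_of_waits _ (hr 1) (ht 1) (hw1 1) (hw2 1), next,
          if_neg (by rw [ih.1 k le_rfl]; omega), if_pos (ih.1 k le_rfl)] at hlk
        split_ifs at hlk with hc
        · refine ⟨fun k' hk' => ?_, ?_⟩
          · rcases Nat.lt_or_eq_of_le hk' with h | rfl
            · exact ih.1 k' (by omega)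
            · rw [← add_assoc, hlk]; omega
          · rw [← add_assoc, hlk, if_neg (by omega)]
            have : g ⟨0, by simp⟩ x (k + 1 - 1) = g ⟨0, by simp⟩ x k := rfl
            rw [this]
            have : g ⟨0, by simp⟩ x k =
              (σ ⟨0, by simp⟩).act (List.replicate (x + 1) r ++ List.replicate k t) t := rfl
            omega
        · exact absurd (by rw [hlk]) (hok l hlo (x + 1 + k + 1))
    intro k
    have hw2 : ∀ i : Fin 3, ∀ j, x + 1 ≤ j → j ≤ x + 1 + k → waits i (l j) = false := by
      intro i j h1 h2
      obtain ⟨k', rfl⟩ := Nat.exists_eq_add_of_le h1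
      simp [waits, (key k).1 k' (by omega)]
    have hw1 : ∀ i : Fin 3, ∀ j < x + 1, waits i (l j) = true := by
      intro i j hj
      simp [waits, hw j (by omega)]
    have hlk := hl (x + 1 + k)
    rw [act_eq_of_waits _ (hr 0) (ht 0) (hw1 0) (hw2 0),
      act_eq_of_waits _ (hr 1) (ht 1) (hw1 1) (hw2 1), next,
      if_neg (by rw [(key k).1 k le_rfl]; omega), if_pos ((key k).1 k le_rfl)] at hlk
    split_ifs at hlk with hc
    · rw [(key k).2] at hc
      exact ⟨Fin.ext hc.1, hc.2⟩
    · exact absurd (by rw [hlk]) (hok l hlo (x + 1 + k + 1))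
  have hnext : ∀ x k, H (g ⟨0, by simp⟩ x (k + 1)) (g ⟨1, by simp⟩ (x + 1) k) = true := by
    intro x
    obtain ⟨l, hlo, hl⟩ := exists_play σ ⟨0, by omega⟩
      (fun j => if j < x then ⟨0, by omega⟩ else ⟨2, by omega⟩)
    have hw := hwait _ x l hlo.1 hl (fun j hj => by simp [hj])
    have h2 : (l (x + 1)).val = 2 := by
      rw [hl, next, if_pos (by rw [hw x le_rfl]; omega)]
      simp
    have h3 : ∀ k, (l (x + 2 + k)).val = 3 := by
      intro k
      induction k with
      | zero =>
        have := hl (x + 1)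
        rw [next, h2] at this
        simpa using this
      | succ k ih =>
        have h := hl (x + 2 + k)
        have hb := hok l hlo (x + 2 + k + 1)
        rw [next, ih] at h
        norm_num at h
        split_ifs at h
        · exact h
        · exact absurd (by rw [h]) hb
    intro k
    have h := hl (x + 2 + k)
    have hb := hok l hlo (x + 2 + k + 1)
    have e0 : (σ ⟨0, by simp⟩).act ((List.range (x + 2 + k)).map l) (l (x + 2 + k)) =
        g ⟨0, by simp⟩ x (k + 1) := by
      have : x + 2 + k = x + 1 + (k + 1) := by omega
      rw [this]
      refine act_eq_of_waits _ (hr 0) (ht 0) (fun j hj => ?_) (fun j hj hj' => ?_)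
      · simp [waits, hw j (by omega)]
      · rcases Nat.lt_or_eq_of_le hj with h | rfl
        · obtain ⟨k', rfl⟩ := Nat.exists_eq_add_of_le (show x + 2 ≤ j by omega)
          simp [waits, h3]
        · simp [waits, h2]
    have e1 : (σ ⟨1, by simp⟩).act ((List.range (x + 2 + k)).map l) (l (x + 2 + k)) =
        g ⟨1, by simp⟩ (x + 1) k := by
      refine act_eq_of_waits _ (hr 1) (ht 1) (fun j hj => ?_) (fun j hj hj' => ?_)
      · rcases Nat.lt_or_eq_of_le (Nat.le_of_lt_succ hj) with h | rfl
        · simp [waits, hw j (by omega)]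
        · simp [waits, h2]
      · obtain ⟨k', rfl⟩ := Nat.exists_eq_add_of_le (show x + 2 ≤ j by omega)
        simp [waits, h3]
    rw [e0, e1, next, h3] at h
    norm_num at h
    split_ifs at h with hc
    · exact hc
    · exact absurd (by rw [h]) hb
  refine ⟨fun x n => g ⟨0, by simp⟩ x (n - x), fun x n => Fin.is_lt _, ?_, fun x => ?_,
    fun x n hxn => ?_, fun x n hxn => ?_⟩
  · simpa using (hsame 0 0).2
  · simpa using (hsame (x + 1) 0).2
  · have := (hsame x (n - x + 1)).2
    rw [if_neg (by omega)] at this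
    rwa [show n + 1 - x = n - x + 1 by omega]
  · have := hnext x (n - (x + 1))
    rw [← (hsame _ _).1] at this
    rwa [show n - x = n - (x + 1) + 1 by omega]

theorem sat_iff_exists_isTiling :
    (game W hW V H).Sat ⟨0, by omega⟩ (.globally {0, 1} (by simp) (.atom 0)) ↔
      ∃ f, IsTiling W V H f :=
  ⟨isTiling_of_sat, fun ⟨_, hf⟩ => sat_of_isTiling hf⟩

end TilingGame

/-- A tile describes a tape cell at some time: whether it is the leftmost cell, its symbol, the
state and the direction with which the head has just arrived, and the state and the direction with
which the head has just left. The direction `true` means to the right. -/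
abbrev Tile : Type := Bool × ℕ × Option (ℕ × Bool) × Option (ℕ × Bool)

namespace Tile

/-- The tile with a given number; `0` and `1` are not numbers of tiles. -/
def ofNum (v : ℕ) : Option Tile := if v < 2 then none else Encodable.decode (v - 2)

/-- The number of a tile. -/
def num (t : Tile) : ℕ := Encodable.encode t + 2

theorem ofNum_num (t : Tile) : ofNum (num t) = some t := by
  simp [ofNum, num]

/-- A bound for the numbers of the tiles with less than `n` states and `m` symbols. -/
def bound (n m : ℕ) : ℕ :=
  Nat.pair 2 (Nat.pair m (Nat.pair (Nat.pair n 2 + 1) (Nat.pair n 2 + 1))) + 2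

theorem three_le_bound (n m : ℕ) : 3 ≤ bound n m := by
  have := Nat.left_le_pair 2 (Nat.pair m (Nat.pair (Nat.pair n 2 + 1) (Nat.pair n 2 + 1)))
  unfold bound
  omega

theorem pair_lt_pair {a b c d : ℕ} (h₁ : a < b) (h₂ : c < d) : Nat.pair a c < Nat.pair b d :=
  (Nat.pair_lt_pair_left c h₁).trans (Nat.pair_lt_pair_right b h₂)

theorem encode_bool_lt (b : Bool) : Encodable.encode b < 2 := by cases b <;> decide

theorem encode_option_lt {n : ℕ} {o : Option (ℕ × Bool)} (h : ∀ p ∈ o, p.1 < n) :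
    Encodable.encode o < Nat.pair n 2 + 1 := by
  rcases o with _ | p
  · simp
  · rw [Encodable.encode_some, Encodable.encode_prod_val]
    exact Nat.succ_lt_succ (pair_lt_pair (h p rfl) (encode_bool_lt _))

theorem num_lt_bound {n m : ℕ} {t : Tile} (h₁ : t.2.1 < m) (h₂ : ∀ p ∈ t.2.2.1, p.1 < n)
    (h₃ : ∀ p ∈ t.2.2.2, p.1 < n) : num t < bound n m := by
  have : Encodable.encode t = Nat.pair (Encodable.encode t.1) (Nat.pair t.2.1
    (Nat.pair (Encodable.encode t.2.2.1) (Encodable.encode t.2.2.2))) := rfl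
  unfold num bound
  rw [this]
  exact Nat.add_lt_add_right (pair_lt_pair (encode_bool_lt _) (pair_lt_pair h₁
    (pair_lt_pair (encode_option_lt h₂) (encode_option_lt h₃)))) 2

/-- The state with which the head moves, if it moves in the direction `d`. -/
def part (d : Bool) (o : Option (ℕ × Bool)) : Option ℕ :=
  o.bind fun p => if p.2 = d then some p.1 else none

@[simp] theorem part_none (d : Bool) : part d none = none := rfl

@[simp] theorem part_some (d : Bool) (p : ℕ × Bool) :
    part d (some p) = if p.2 = d then some p.1 else none := rfl

theorem map_fst_eq_part_or (o : Option (ℕ × Bool)) :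
    o.map Prod.fst = (part true o).or (part false o) := by
  rcases o with _ | ⟨q, _ | _⟩ <;> simp

/-- The table entry for state `q` and symbol `a` in the description of a machine. -/
def lookup (c : TM.Code) (q a : ℕ) : Option (ℕ × ℕ × Bool) :=
  ((c.2.2.2[q]?).bind fun r => r[a]?).bind id

/-- The new symbol and the departure of the head in the next tile of the column. -/
def react (c : TM.Code) (t : Tile) : Option (ℕ × Option (ℕ × Bool)) :=
  if t.2.2.1 = none then some (t.2.1, none) else
    t.2.2.1.bind fun p => (lookup c p.1 t.2.1).bind fun u =>
      if t.1 = true ∧ u.2.2 = false then none else some (u.2.1, some (u.1, u.2.2))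

/-- The parts of the next tile of the column that are determined: the leftmost-flag, the symbol
and the departure of the head. -/
def expected (c : TM.Code) (v : ℕ) : Option (Bool × ℕ × Option (ℕ × Bool)) :=
  if v < 2 then some (decide (v = 0), c.2.2.1, none)
  else (ofNum v).bind fun t => (react c t).map fun u => (t.1, u)

/-- The restriction on the arrival of the head in the next tile of the column. -/
def arrivalOk (c : TM.Code) (v : ℕ) (t : Tile) : Bool :=
  if v = 0 then decide (t.2.2.1 = some (c.2.1, true))
  else if v = 1 then decide (part false t.2.2.1 = none)
  else decide (t.1 = false ∨ part true t.2.2.1 = none)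

/-- The relation between consecutive tiles of a column. -/
def vertOk (c : TM.Code) (v w : ℕ) : Bool :=
  ((ofNum w).map fun t => decide (expected c v = some (t.1, t.2.1, t.2.2.2)) &&
    arrivalOk c v t).getD false

/-- The relation between neighbouring tiles of a row. -/
def horizOk (v w : ℕ) : Bool :=
  ((ofNum v).bind fun t => (ofNum w).map fun u =>
    decide (part true t.2.2.2 = part true u.2.2.1) &&
      decide (part false u.2.2.2 = part false t.2.2.1)).getD false

theorem vertOk_iff {c : TM.Code} {v w : ℕ} : vertOk c v w = true ↔
    ∃ t, ofNum w = some t ∧ expected c v = some (t.1, t.2.1, t.2.2.2) ∧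
      arrivalOk c v t = true := by
  unfold vertOk
  cases ofNum w <;> simp

theorem horizOk_iff {v w : ℕ} {t u : Tile} (ht : ofNum v = some t) (hu : ofNum w = some u) :
    horizOk v w = true ↔ part true t.2.2.2 = part true u.2.2.1 ∧
      part false u.2.2.2 = part false t.2.2.1 := by
  simp [horizOk, ht, hu]

theorem expected_of_ofNum {c : TM.Code} {v : ℕ} {t : Tile} (h : ofNum v = some t) :
    expected c v = (react c t).map fun u => (t.1, u) := by
  have : ¬ v < 2 := fun h' => by simp [ofNum, h'] at h
  simp [expected, this, h]

theorem arrivalOk_of_ofNum {c : TM.Code} {v : ℕ} {t u : Tile} (h : ofNum v = some t) :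
    arrivalOk c v u = true ↔ u.1 = false ∨ part true u.2.2.1 = none := by
  have : ¬ v < 2 := fun h' => by simp [ofNum, h'] at h
  rw [arrivalOk, if_neg (by omega), if_neg (by omega), decide_eq_true_iff]

end Tile

namespace TM

open Tile

variable {n m : ℕ} (M : TM (Fin n) (Fin m))

/-- The direction `true` means to the right. -/
def dirBool : Turing.Dir → Bool
  | .left => false
  | .right => true

theorem lookup_code (q : Fin n) (a : Fin m) :
    lookup M.code q a = (M.δ q a).map fun t => (t.1.val, t.2.1.val, dirBool t.2.2) := by
  simp only [lookup, code]
  rw [List.getElem?_ofFn, dif_pos q.2, Option.bind_some, List.getElem?_ofFn, dif_pos a.2]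
  rcases M.δ q a with _ | ⟨q', b, _ | _⟩ <;> simp [dirBool]

variable {M}

theorem step_eq_some {Q A : Type} {M : TM Q A} {c c' : Cfg Q A} (h : M.step c = some c') :
    ∃ q b d, M.δ c.state (c.tape c.head) = some (q, b, d) ∧ c'.state = q ∧
      c'.tape = Function.update c.tape c.head b ∧
      (d = .right ∧ c'.head = c.head + 1 ∨ d = .left ∧ c.head = c'.head + 1) := by
  obtain ⟨s, hd, tp⟩ := c
  unfold step at h
  dsimp only at h ⊢
  split at h
  · simp at h
  · next e1 =>
    cases h
    exact ⟨_, _, _, e1, rfl, rfl, Or.inl ⟨rfl, rfl⟩⟩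
  · simp at h
  · next e1 =>
    cases h
    exact ⟨_, _, _, e1, rfl, rfl, Or.inr ⟨rfl, rfl⟩⟩

theorem exists_step {Q A : Type} {M : TM Q A} {c : Cfg Q A} {q : Q} {b : A} {d : Turing.Dir}
    (h : M.δ c.state (c.tape c.head) = some (q, b, d)) (hd : ¬ (c.head = 0 ∧ d = .left)) :
    ∃ c', M.step c = some c' := by
  obtain ⟨s, p, tp⟩ := c
  rcases d with _ | _
  · rcases p with _ | p
    · simp at hd
    · exact ⟨_, by unfold step; dsimp only at h ⊢; rw [h]⟩
  · exact ⟨_, by unfold step; dsimp only at h ⊢; rw [h]⟩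

theorem exists_run {Q A : Type} {M : TM Q A} (h : ¬ M.Halts) :
    ∃ r : ℕ → Cfg Q A, r 0 = M.init ∧ ∀ k, M.step (r k) = some (r (k + 1)) := by
  let r : ℕ → Cfg Q A := fun k => Nat.rec M.init (fun _ c => (M.step c).getD c) k
  have hs : ∀ k, Relation.ReflTransGen (fun c c' => M.step c = some c') M.init (r k) →
      M.step (r k) = some (r (k + 1)) := by
    intro k hk
    obtain ⟨c', hc'⟩ := Option.ne_none_iff_exists'.1 fun hn => h ⟨_, hk, hn⟩
    have e : r (k + 1) = (M.step (r k)).getD (r k) := rfl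
    rw [e, hc', Option.getD_some]
  have hr : ∀ k, Relation.ReflTransGen (fun c c' => M.step c = some c') M.init (r k) := by
    intro k
    induction k with
    | zero => exact .refl
    | succ k ih => exact ih.tail (hs k ih)
  exact ⟨r, rfl, fun k => hs k (hr k)⟩

/-- The direction of the last move before time `k`, and `true` for `k = 0`. -/
def arrivalDir (r : ℕ → Cfg (Fin n) (Fin m)) (k : ℕ) : Bool :=
  decide (k = 0 ∨ (r (k - 1)).head < (r k).head)

/-- The tile that describes cell `x` at time `k` of a run. -/
def runTile (r : ℕ → Cfg (Fin n) (Fin m)) (x k : ℕ) : Tile :=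
  (decide (x = 0), (r k).tape x,
    if (r k).head = x then some ((r k).state.val, arrivalDir r k) else none,
    if 1 ≤ k ∧ (r (k - 1)).head = x then some ((r k).state.val, arrivalDir r k) else none)

theorem isTiling_of_run {r : ℕ → Cfg (Fin n) (Fin m)} (h0 : r 0 = M.init)
    (hr : ∀ k, M.step (r k) = some (r (k + 1))) :
    IsTiling (bound n m) (vertOk M.code) horizOk (fun x k => num (runTile r x k)) := by
  have hhead : ∀ k, (r k).head ≤ k := by
    intro k
    induction k with
    | zero => simp [h0, init]
    | succ k ih =>
      obtain ⟨q, b, d, -, -, -, h⟩ := step_eq_some (hr k)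
      omega
  have hblank : ∀ k y, k ≤ y → (r k).tape y = M.blank := by
    intro k
    induction k with
    | zero => simp [h0, init]
    | succ k ih =>
      intro y hy
      obtain ⟨q, b, d, -, -, ht, -⟩ := step_eq_some (hr k)
      have := hhead k
      rw [ht, Function.update_of_ne (by omega), ih y (by omega)]
  constructor
  · intro x k
    refine num_lt_bound (Fin.is_lt _) ?_ ?_ <;>
    · intro p hp
      simp only [runTile] at hp
      split_ifs at hp
      · cases hp; exact Fin.is_lt _
      · cases hp
  · refine vertOk_iff.2 ⟨_, ofNum_num _, ?_, ?_⟩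
    · simp [expected, runTile, h0, init, code]
    · simp [arrivalOk, runTile, h0, init, code, arrivalDir]
  · intro x
    have h1 := hhead x
    have h2 := hblank (x + 1) (x + 1) le_rfl
    refine vertOk_iff.2 ⟨_, ofNum_num _, ?_, ?_⟩
    · have : (r x).head ≠ x + 1 := by omega
      simp [expected, runTile, h2, code, this]
    · simp only [arrivalOk, runTile, arrivalDir]
      by_cases h : (r (x + 1)).head = x + 1
      · have : (r x).head < (r (x + 1)).head := by omega
        simp [h]
        omega
      · simp [h]
  · intro x k _
    obtain ⟨q, b, d, hδ, hq, ht, hm⟩ := step_eq_some (hr k)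
    refine vertOk_iff.2 ⟨_, ofNum_num _, ?_, (arrivalOk_of_ofNum (ofNum_num _)).2 ?_⟩
    · rw [expected_of_ofNum (ofNum_num _)]
      by_cases h : (r k).head = x
      · subst h
        have hl := lookup_code M (r k).state ((r k).tape (r k).head)
        rw [hδ] at hl
        rcases hm with ⟨rfl, hm⟩ | ⟨rfl, hm⟩
        · simp [react, runTile, hl, hq, ht, hm, dirBool, arrivalDir]
        · have h1 : (r k).head ≠ 0 := by omega
          have h2 : (r (k + 1)).head ≤ (r k).head := by omega
          simp [react, runTile, hl, hq, ht, h1, h2, dirBool, arrivalDir]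
      · have h' : x ≠ (r k).head := fun e => h e.symm
        simp [react, runTile, h, ht, h']
    · simp only [runTile, arrivalDir]
      rcases x with _ | x
      · right
        by_cases h : (r (k + 1)).head = 0 <;> simp [h]
      · simp
  · intro x k hk
    obtain ⟨k, rfl⟩ : ∃ k', k = k' + 1 := ⟨k - 1, by omega⟩
    obtain ⟨q, b, d, -, -, -, hm⟩ := step_eq_some (hr k)
    rw [horizOk_iff (ofNum_num _) (ofNum_num _)]
    simp only [runTile, arrivalDir]
    constructor
    · by_cases h1 : (r k).head = x <;> by_cases h2 : (r (k + 1)).head = x + 1 <;>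
        simp [h1, h2] <;> omega
    · by_cases h1 : (r k).head = x + 1 <;> by_cases h2 : (r (k + 1)).head = x <;>
        simp [h1, h2] <;> omega

/-- The column part of a tiling agrees with the configuration `c` at time `k`. -/
structure Describes (M : TM (Fin n) (Fin m)) (f : ℕ → ℕ → ℕ) (k : ℕ) (c : Cfg (Fin n) (Fin m)) :
    Prop where
  head_le : c.head ≤ k
  blank : ∀ x, k < x → c.tape x = M.blank
  tile : ∀ x ≤ k, ∃ t, ofNum (f x k) = some t ∧ t.1 = decide (x = 0) ∧ t.2.1 = c.tape x ∧
    t.2.2.1.map Prod.fst = if x = c.head then some c.state.val else none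

theorem describes_init {f : ℕ → ℕ → ℕ}
    (hf : IsTiling (bound n m) (vertOk M.code) horizOk f) : Describes M f 0 M.init := by
  refine ⟨le_rfl, fun _ _ => rfl, fun x hx => ?_⟩
  obtain rfl : x = 0 := by omega
  obtain ⟨t, ht, he, ha⟩ := vertOk_iff.1 hf.corner
  simp [expected, code] at he
  rw [arrivalOk, if_pos rfl, decide_eq_true_iff] at ha
  exact ⟨t, ht, by simp [← he.1], by simp [← he.2.1, init], by rw [ha]; rfl⟩

theorem Describes.step {f : ℕ → ℕ → ℕ} (hf : IsTiling (bound n m) (vertOk M.code) horizOk f)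
    {k : ℕ} {c : Cfg (Fin n) (Fin m)} (h : Describes M f k c) :
    ∃ c', M.step c = some c' ∧ Describes M f (k + 1) c' := by
  obtain ⟨q, b, d, hδ, hd⟩ : ∃ q b d, M.δ c.state (c.tape c.head) = some (q, b, d) ∧
      ¬ (c.head = 0 ∧ d = .left) := by
    obtain ⟨t, ht, hflag, hsym, hrecv⟩ := h.tile c.head h.head_le
    obtain ⟨u, hu, he, -⟩ := vertOk_iff.1 (hf.vert c.head k h.head_le)
    rw [if_pos rfl] at hrecv
    obtain ⟨p, hp, hp1⟩ := Option.map_eq_some_iff.1 hrecv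
    rw [expected_of_ofNum ht] at he
    rw [react, hp, hsym, hflag, if_neg (by simp), Option.bind_some, hp1, lookup_code] at he
    rcases hδ : M.δ c.state (c.tape c.head) with _ | ⟨q, b, d⟩
    · simp [hδ] at he
    · refine ⟨q, b, d, rfl, ?_⟩
      rintro ⟨e1, rfl⟩
      rw [hδ] at he
      simp [e1, dirBool] at he
  obtain ⟨c', hc'⟩ := exists_step hδ hd
  refine ⟨c', hc', ?_⟩
  obtain ⟨q', b', d', hδ', hq, htape, hmove⟩ := step_eq_some hc'
  obtain ⟨rfl, rfl, rfl⟩ : q = q' ∧ b = b' ∧ d = d' := by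
    rw [hδ] at hδ'; simpa using hδ'
  have hle := h.head_le
  have hnew : ∀ x ≤ k + 1, ∃ t, ofNum (f x (k + 1)) = some t ∧ t.1 = decide (x = 0) ∧
      t.2.1 = c'.tape x ∧ t.2.2.2 = (if x = c.head then some (q.val, dirBool d) else none) ∧
      (x = 0 → part true t.2.2.1 = none) ∧ (x = k + 1 → part false t.2.2.1 = none) := by
    intro x hx
    rcases Nat.lt_or_eq_of_le hx with hx' | rfl
    · obtain ⟨t, ht, hflag, hsym, hrecv⟩ := h.tile x (by omega)
      obtain ⟨u, hu, he, ha⟩ := vertOk_iff.1 (hf.vert x k (by omega))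
      rw [expected_of_ofNum ht] at he
      rw [arrivalOk_of_ofNum ht] at ha
      refine ⟨u, hu, ?_⟩
      have hx0 : u.1 = decide (x = 0) → x = 0 → part true u.2.2.1 = none := by
        intro h1 h2
        rcases ha with ha | ha
        · simp [h1, h2] at ha
        · exact ha
      by_cases hxc : x = c.head
      · subst hxc
        rw [if_pos rfl] at hrecv
        obtain ⟨p, hp, hp1⟩ := Option.map_eq_some_iff.1 hrecv
        have hn : ¬ (c.head = 0 ∧ dirBool d = false) := by
          rintro ⟨e1, e2⟩
          cases d
          · exact hd ⟨e1, rfl⟩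
          · simp [dirBool] at e2
        rw [react, hp, hsym, hflag, if_neg (by simp), Option.bind_some, hp1, lookup_code, hδ] at he
        simp [hn] at he
        refine ⟨by simp [← he.1], by simp [← he.2.1, htape], by simp [← he.2.2],
          hx0 (by simp [← he.1]), by omega⟩
      · rw [if_neg hxc, Option.map_eq_none_iff] at hrecv
        rw [react, hrecv, if_pos rfl, hsym, hflag] at he
        simp at he
        refine ⟨by simp [← he.1], by simp [← he.2.1, htape, hxc], by simp [← he.2.2, hxc],
          hx0 (by simp [← he.1]), by omega⟩
    · obtain ⟨u, hu, he, ha⟩ := vertOk_iff.1 (hf.diag k)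
      simp [expected, code] at he
      simp [arrivalOk] at ha
      refine ⟨u, hu, by simp [← he.1], ?_, ?_, by simp, by simp [ha]⟩
      · rw [← he.2.1, htape, Function.update_of_ne (by omega), h.blank _ (by omega)]
      · rw [← he.2.2, if_neg (by omega)]
  refine ⟨by omega, fun x hx => ?_, fun x hx => ?_⟩
  · rw [htape, Function.update_of_ne (by omega), h.blank _ (by omega)]
  · obtain ⟨t, ht, hflag, hsym, -, hx0, hxk⟩ := hnew x hx
    refine ⟨t, ht, hflag, hsym, ?_⟩
    have hright : part true t.2.2.1 = if x = c.head + 1 ∧ d = .right then some q.val else none := by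
      rcases x with _ | x
      · rw [hx0 rfl, if_neg (by omega)]
      · obtain ⟨u, hu, -, -, hsent, -⟩ := hnew x (by omega)
        rw [← ((horizOk_iff hu ht).1 (hf.horiz x (k + 1) (by omega))).1, hsent]
        by_cases e : x = c.head <;> cases d <;> simp [e, dirBool]
    have hleft : part false t.2.2.1 = if x + 1 = c.head ∧ d = .left then some q.val else none := by
      rcases Nat.lt_or_eq_of_le hx with hx' | rfl
      · obtain ⟨u, hu, -, -, hsent, -⟩ := hnew (x + 1) (by omega)
        rw [← ((horizOk_iff ht hu).1 (hf.horiz x (k + 1) (by omega))).2, hsent]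
        by_cases e : x + 1 = c.head <;> cases d <;> simp [e, dirBool]
      · rw [hxk rfl, if_neg (by omega)]
    rw [map_fst_eq_part_or, hright, hleft, hq]
    rcases hmove with ⟨rfl, hmove⟩ | ⟨rfl, hmove⟩
    · simp [hmove]
    · simp [hmove]

theorem exists_isTiling_iff :
    (∃ f, IsTiling (bound n m) (vertOk M.code) horizOk f) ↔ ¬ M.Halts := by
  constructor
  · rintro ⟨f, hf⟩ ⟨c, hc, hn⟩
    have : ∃ k, Describes M f k c := by
      clear hn
      induction hc with
      | refl => exact ⟨0, describes_init hf⟩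
      | tail _ h ih =>
        obtain ⟨k, hk⟩ := ih
        obtain ⟨c', hc', hk'⟩ := hk.step hf
        obtain rfl := Option.some.inj (hc'.symm.trans h)
        exact ⟨_, hk'⟩
    obtain ⟨k, hk⟩ := this
    obtain ⟨c', hc', -⟩ := hk.step hf
    simp [hn] at hc'
  · intro h
    obtain ⟨r, h0, hr⟩ := exists_run h
    exact ⟨_, isTiling_of_run h0 hr⟩

end TM

namespace Tile

variable {α : Type} [Primcodable α]

theorem primrec_bound : Primrec₂ bound := by
  have h : Primrec fun p : ℕ × ℕ => Nat.pair p.1 2 + 1 :=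
    Primrec.succ.comp (Primrec₂.natPair.comp .fst (.const 2))
  exact Primrec.nat_add.comp (Primrec₂.natPair.comp (.const 2)
    (Primrec₂.natPair.comp .snd (Primrec₂.natPair.comp h h))) (.const 2)

theorem primrec_ofNum : Primrec ofNum :=
  Primrec.ite (Primrec.nat_lt.comp .id (.const 2)) (.const none)
    (Primrec.decode.comp (Primrec.nat_sub.comp .id (.const 2)))

theorem primrec_part (d : Bool) : Primrec (part d) :=
  Primrec.option_bind .id (Primrec.ite
    (Primrec.eq.comp (Primrec.snd.comp .snd) (.const d))
    (Primrec.option_some.comp (Primrec.fst.comp .snd)) (.const none))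

theorem primrec_lookup {c : α → TM.Code} {q a : α → ℕ} (hc : Primrec c) (hq : Primrec q)
    (ha : Primrec a) : Primrec fun x => lookup (c x) (q x) (a x) := by
  have ht : Primrec fun x => (c x).2.2.2 := Primrec.snd.comp (Primrec.snd.comp (Primrec.snd.comp hc))
  exact Primrec.option_bind (Primrec.option_bind (Primrec.list_getElem?.comp ht hq)
    (Primrec.list_getElem?.comp .snd (ha.comp .fst))) Primrec.snd

theorem primrec_react {c : α → TM.Code} {t : α → Tile} (hc : Primrec c) (ht : Primrec t) :
    Primrec fun x => react (c x) (t x) := by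
  have hsym : Primrec fun x => (t x).2.1 := Primrec.fst.comp (Primrec.snd.comp ht)
  have hrecv : Primrec fun x => (t x).2.2.1 :=
    Primrec.fst.comp (Primrec.snd.comp (Primrec.snd.comp ht))
  have hflag : Primrec fun x => (t x).1 := Primrec.fst.comp ht
  refine Primrec.ite (Primrec.eq.comp hrecv (.const none))
    (Primrec.option_some.comp (Primrec.pair hsym (.const none))) ?_
  refine Primrec.option_bind hrecv (Primrec.option_bind
    (primrec_lookup (hc.comp .fst) (Primrec.fst.comp .snd) (hsym.comp .fst)) ?_)
  have hu : Primrec fun y : (α × ℕ × Bool) × ℕ × ℕ × Bool => y.2.2.2 :=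
    Primrec.snd.comp (Primrec.snd.comp .snd)
  refine Primrec.ite (PrimrecPred.and
    (Primrec.eq.comp (hflag.comp (Primrec.fst.comp .fst)) (.const true))
    (Primrec.eq.comp hu (.const false))) (.const none) ?_
  exact Primrec.option_some.comp (Primrec.pair (Primrec.fst.comp (Primrec.snd.comp .snd))
    (Primrec.option_some.comp (Primrec.pair (Primrec.fst.comp .snd) hu)))

theorem primrec_expected {c : α → TM.Code} {v : α → ℕ} (hc : Primrec c) (hv : Primrec v) :
    Primrec fun x => expected (c x) (v x) := by
  refine Primrec.ite (Primrec.nat_lt.comp hv (.const 2)) (Primrec.option_some.comp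
    (Primrec.pair ((Primrec.eq.comp hv (.const 0)).decide) (Primrec.pair
      (Primrec.fst.comp (Primrec.snd.comp (Primrec.snd.comp hc))) (.const none)))) ?_
  exact Primrec.option_bind (primrec_ofNum.comp hv) (Primrec.option_map
    (primrec_react (hc.comp .fst) .snd)
    (Primrec.pair (Primrec.fst.comp (Primrec.snd.comp .fst)) .snd))

theorem primrec_arrivalOk {c : α → TM.Code} {v : α → ℕ} {t : α → Tile} (hc : Primrec c)
    (hv : Primrec v) (ht : Primrec t) : Primrec fun x => arrivalOk (c x) (v x) (t x) := by
  have hrecv : Primrec fun x => (t x).2.2.1 :=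
    Primrec.fst.comp (Primrec.snd.comp (Primrec.snd.comp ht))
  refine Primrec.ite (Primrec.eq.comp hv (.const 0)) (PrimrecPred.decide (Primrec.eq.comp hrecv
    (Primrec.option_some.comp (Primrec.pair (Primrec.fst.comp (Primrec.snd.comp hc))
      (.const true))))) ?_
  refine Primrec.ite (Primrec.eq.comp hv (.const 1)) (PrimrecPred.decide (Primrec.eq.comp
    ((primrec_part false).comp hrecv) (.const none))) ?_
  exact PrimrecPred.decide (PrimrecPred.or (Primrec.eq.comp (Primrec.fst.comp ht) (.const false))
    (Primrec.eq.comp ((primrec_part true).comp hrecv) (.const none)))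

theorem primrec_vertOk {c : α → TM.Code} {v w : α → ℕ} (hc : Primrec c) (hv : Primrec v)
    (hw : Primrec w) : Primrec fun x => vertOk (c x) (v x) (w x) := by
  refine Primrec.option_getD.comp (Primrec.option_map (primrec_ofNum.comp hw) ?_) (.const false)
  refine Primrec.and.comp (PrimrecPred.decide (Primrec.eq.comp
    (primrec_expected (hc.comp .fst) (hv.comp .fst)) (Primrec.option_some.comp
      (Primrec.pair (Primrec.fst.comp .snd) (Primrec.pair
        (Primrec.fst.comp (Primrec.snd.comp .snd))
        (Primrec.snd.comp (Primrec.snd.comp (Primrec.snd.comp .snd))))))))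
    (primrec_arrivalOk (hc.comp .fst) (hv.comp .fst) .snd)

theorem primrec_horizOk {v w : α → ℕ} (hv : Primrec v) (hw : Primrec w) :
    Primrec fun x => horizOk (v x) (w x) := by
  have h1 : Primrec fun t : Tile => t.2.2.1 :=
    Primrec.fst.comp (Primrec.snd.comp .snd)
  have h2 : Primrec fun t : Tile => t.2.2.2 :=
    Primrec.snd.comp (Primrec.snd.comp .snd)
  refine Primrec.option_getD.comp (Primrec.option_bind (primrec_ofNum.comp hv)
    (Primrec.option_map (primrec_ofNum.comp (hw.comp .fst)) ?_)) (.const false)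
  exact Primrec.and.comp
    (PrimrecPred.decide (Primrec.eq.comp
      ((primrec_part true).comp (h2.comp (Primrec.snd.comp .fst)))
      ((primrec_part true).comp (h1.comp .snd))))
    (PrimrecPred.decide (Primrec.eq.comp
      ((primrec_part false).comp (h2.comp .snd))
      ((primrec_part false).comp (h1.comp (Primrec.snd.comp .fst)))))

end Tile

namespace TilingGame

variable {α : Type} [Primcodable α]

theorem primrec_next {V H : α → ℕ → ℕ → Bool}
    (hV : Primrec fun p : α × ℕ × ℕ => V p.1 p.2.1 p.2.2)
    (hH : Primrec fun p : α × ℕ × ℕ => H p.1 p.2.1 p.2.2) {s a b e : α → ℕ} (hs : Primrec s)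
    (ha : Primrec a) (hb : Primrec b) (he : Primrec e) :
    Primrec fun x => next (V x) (H x) (s x) (a x) (b x) (e x) := by
  have hk : Primrec fun x => s x % 5 := Primrec.nat_mod.comp hs (.const 5)
  have hq : ∀ k, PrimrecPred fun x => s x % 5 = k := fun k => Primrec.eq.comp hk (.const k)
  have hVx : Primrec fun x => V x (s x / 5) (a x) :=
    hV.comp (Primrec.pair .id (Primrec.pair (Primrec.nat_div.comp hs (.const 5)) ha))
  have hHx : Primrec fun x => H x (a x) (b x) :=
    hH.comp (Primrec.pair .id (Primrec.pair ha hb))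
  refine Primrec.ite (hq 0) (Primrec.ite (Primrec.eq.comp he (.const 0)) (.const 5)
    (Primrec.ite (Primrec.eq.comp he (.const 1)) (Primrec.succ.comp hs) (.const 2))) ?_
  refine Primrec.ite (hq 1) (Primrec.ite (PrimrecPred.and (Primrec.eq.comp ha hb)
    (Primrec.eq.comp hVx (.const true))) (Primrec.succ.comp
      (Primrec.nat_mul.comp (.const 5) ha)) (.const 4)) ?_
  exact Primrec.ite (hq 2) (.const 3) (Primrec.ite (hq 3)
    (Primrec.ite (Primrec.eq.comp hHx (.const true)) (.const 3) (.const 4)) (.const 4))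

theorem primrec_waits : Primrec₂ waits := by
  have hk : Primrec fun p : ℕ × ℕ => p.2 % 5 := Primrec.nat_mod.comp .snd (.const 5)
  exact PrimrecPred.decide (PrimrecPred.or (Primrec.eq.comp hk (.const 0))
    (PrimrecPred.and (Primrec.eq.comp .fst (.const 1)) (Primrec.eq.comp hk (.const 2))))

/-- The description of the game, its initial state and the formula `⟨⟨0, 1⟩⟩ □ ok`. -/
def description (W : ℕ) (V H : ℕ → ℕ → Bool) : InstanceCode :=
  ((3, 5 * W, 1, W),
    (List.range (5 * W)).map (fun s => [decide (s % 5 ≠ 4)]),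
    (List.range 3).map (fun i => (List.range (5 * W)).map fun s =>
      (List.range (5 * W)).map fun t => decide (waits i s = waits i t)),
    (List.range 3).map (fun _ => (List.range (5 * W)).map fun _ =>
      (List.range W).map fun _ => true),
    (List.range (5 * W)).map (fun s => (List.range (W * (W * W))).map fun x =>
      some (next V H s (x % W) (x / W % W) (x / (W * W) % W))),
    0, [4, 1, 1, 0, 0, 0])

theorem primrec_description {W : α → ℕ} {V H : α → ℕ → ℕ → Bool} (hW : Primrec W)
    (hV : Primrec fun p : α × ℕ × ℕ => V p.1 p.2.1 p.2.2)
    (hH : Primrec fun p : α × ℕ × ℕ => H p.1 p.2.1 p.2.2) :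
    Primrec fun x => description (W x) (V x) (H x) := by
  have h5 : Primrec fun x => 5 * W x := Primrec.nat_mul.comp (.const 5) hW
  have hWW : Primrec fun x => W x * W x := Primrec.nat_mul.comp hW hW
  have hr : Primrec fun x => List.range (5 * W x) := Primrec.list_range.comp h5
  refine Primrec.pair (Primrec.pair (.const 3) (Primrec.pair h5 (Primrec.pair (.const 1) hW)))
    (Primrec.pair ?_ (Primrec.pair ?_ (Primrec.pair ?_ (Primrec.pair ?_ (.const _)))))
  · exact Primrec.list_map hr (Primrec.list_cons.comp (PrimrecPred.decide (PrimrecPred.not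
      (Primrec.eq.comp (Primrec.nat_mod.comp .snd (.const 5)) (.const 4)))) (.const []))
  · refine Primrec.list_map (.const _) (Primrec.list_map (hr.comp .fst) (Primrec.list_map
      (hr.comp (Primrec.fst.comp .fst)) (PrimrecPred.decide (Primrec.eq.comp
        (primrec_waits.comp (Primrec.snd.comp (Primrec.fst.comp .fst)) (Primrec.snd.comp .fst))
        (primrec_waits.comp (Primrec.snd.comp (Primrec.fst.comp .fst)) .snd)))))
  · exact Primrec.list_map (.const _) (Primrec.list_map (hr.comp .fst) (Primrec.list_map
      (Primrec.list_range.comp (hW.comp (Primrec.fst.comp .fst))) (.const true)))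
  · refine Primrec.list_map hr (Primrec.list_map (Primrec.list_range.comp
      (Primrec.nat_mul.comp (hW.comp .fst) (hWW.comp .fst))) (Primrec.option_some.comp ?_))
    have hx : Primrec fun y : (α × ℕ) × ℕ => y.1.1 := Primrec.fst.comp .fst
    exact primrec_next (V := fun y : (α × ℕ) × ℕ => V y.1.1) (H := fun y => H y.1.1)
      (hV.comp (Primrec.pair (hx.comp .fst) .snd)) (hH.comp (Primrec.pair (hx.comp .fst) .snd))
      (Primrec.snd.comp .fst) (Primrec.nat_mod.comp .snd (hW.comp hx))
      (Primrec.nat_mod.comp (Primrec.nat_div.comp .snd (hW.comp hx)) (hW.comp hx))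
      (Primrec.nat_mod.comp (Primrec.nat_div.comp .snd (hWW.comp hx)) (hW.comp hx))

theorem ofFn_eq_map_range {β : Type} {n : ℕ} {f : Fin n → β} {g : ℕ → β}
    (h : ∀ i, f i = g i) : List.ofFn f = (List.range n).map g := by
  apply List.ext_getElem <;> simp [h]

theorem description_eq_code {W : ℕ} {hW : 3 ≤ W} {V H : ℕ → ℕ → Bool} :
    description W V H = Instance.code
      { numAgents := 3, numStates := 5 * W, numProps := 1, numActs := W
        agents_pos := by decide
        states_pos := by omega, props_pos := by decide, acts_pos := by omega
        G := game W hW V H, state := ⟨0, by omega⟩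
        formula := .globally {0, 1} (by simp) (.atom 0) } := by
  have h3 : W * (W * W) = W ^ 3 := by ring
  unfold description Instance.code
  congr 1
  refine congrArg₂ Prod.mk ?_ (congrArg₂ Prod.mk ?_ (congrArg₂ Prod.mk ?_
    (congrArg₂ Prod.mk ?_ (congrArg₂ Prod.mk rfl ?_))))
  · refine (ofFn_eq_map_range fun s => ?_).symm
    by_cases h : s.val % 5 = 4 <;> simp [game, h]
  · refine (ofFn_eq_map_range fun i => ?_).symm
    refine ofFn_eq_map_range fun s => ofFn_eq_map_range fun t => ?_
    simp [game_obs]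
  · refine (ofFn_eq_map_range fun i => ?_).symm
    refine ofFn_eq_map_range fun s => ofFn_eq_map_range fun t => ?_
    simp [game]
  · refine (ofFn_eq_map_range fun s => ?_).symm
    rw [h3]
    refine ofFn_eq_map_range fun x => ?_
    simp [game, finFunctionFinEquiv, pow_two]
  · simp [Formula.code, List.ofFn_succ]

end TilingGame

/-- The reduction on the level of descriptions. -/
def reduction (c : TM.Code) : InstanceCode :=
  TilingGame.description (Tile.bound c.1.1 c.1.2) (Tile.vertOk c) Tile.horizOk

theorem primrec_reduction : Primrec reduction :=
  TilingGame.primrec_description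
    (Tile.primrec_bound.comp (Primrec.fst.comp .fst) (Primrec.snd.comp .fst))
    (Tile.primrec_vertOk .fst (Primrec.fst.comp .snd) (Primrec.snd.comp .snd))
    (Tile.primrec_horizOk (Primrec.fst.comp .snd) (Primrec.snd.comp .snd))

/-- The description of every machine is transformed into the description of a game that is
won by the agents `0` and `1` if and only if the machine does not halt. -/
theorem reduction_correct {n m : ℕ} (M : TM (Fin n) (Fin m)) :
    ∃ (S P Act : ℕ) (hS : 0 < S) (hP : 0 < P) (hAct : 0 < Act)
      (G : CGS (Fin 3) (Fin S) (Fin P) (Fin Act)) (sInit : Fin S) (ok : Fin P),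
      reduction M.code = Instance.code
        { numAgents := 3, numStates := S, numProps := P, numActs := Act
          agents_pos := by decide
          states_pos := hS, props_pos := hP, acts_pos := hAct
          G := G, state := sInit
          formula := .globally {0, 1} (by simp) (.atom ok) } ∧
      (¬ M.Halts ↔ G.Sat sInit (.globally {0, 1} (by simp) (.atom ok))) :=
  have hW := Tile.three_le_bound n m
  ⟨5 * Tile.bound n m, 1, Tile.bound n m, by omega, by decide, by omega,
    TilingGame.game _ hW (Tile.vertOk M.code) Tile.horizOk, ⟨0, by omega⟩, 0,
    TilingGame.description_eq_code,
    TM.exists_isTiling_iff.symm.trans TilingGame.sat_iff_exists_isTiling.symm⟩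

open Turing StateTransition

theorem trNat_two_pow (k : ℕ) :
    PartrecToTM2.trNat (2 ^ k) = List.replicate k .bit0 ++ [.bit1] := by
  have key : ∃ p : PosNum, (p : ℕ) = 2 ^ k ∧
      PartrecToTM2.trPosNum p = List.replicate k .bit0 ++ [.bit1] := by
    induction k with
    | zero => exact ⟨.one, rfl, rfl⟩
    | succ k ih =>
      obtain ⟨p, hp, ht⟩ := ih
      refine ⟨.bit0 p, ?_, ?_⟩
      · rw [PosNum.cast_bit0, hp]; ring
      · rw [PartrecToTM2.trPosNum, ht]; rfl
  obtain ⟨p, hp, ht⟩ := key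
  rw [PartrecToTM2.trNat, ← hp, ← ht]
  have : ((p : ℕ) : Num) = Num.pos p := by
    rw [← PosNum.cast_to_num, PosNum.cast_to_nat]
  rw [this]; rfl

instance : Finite PartrecToTM2.K' :=
  Finite.of_surjective (α := Fin 4) ![.main, .rev, .aux, .stack] fun k => by
    cases k
    exacts [⟨0, rfl⟩, ⟨1, rfl⟩, ⟨2, rfl⟩, ⟨3, rfl⟩]

instance {K : Type} {Γ : K → Type} [Finite K] [∀ k, Finite (Γ k)] :
    Finite (TM2to1.Γ' K Γ) :=
  inferInstanceAs (Finite (Bool × ∀ k, Option (Γ k)))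

/-- A machine can be restricted to a set of states that supports it. -/
theorem exists_restrict {Γ Λ : Type} [Inhabited Γ] [Inhabited Λ] (M : TM0.Machine Γ Λ) {S : Set Λ}
    (hS : TM0.Supports M S) : ∃ (_ : Inhabited S) (M' : TM0.Machine Γ S),
      ∀ l, (TM0.eval M' l).Dom ↔ (TM0.eval M l).Dom := by
  have h : ∀ (q : S) a, ∃ o : Option (S × TM0.Stmt Γ),
      o.map (fun p => (p.1.1, p.2)) = M q.1 a := by
    intro q a
    rcases h : M q.1 a with _ | ⟨q', s⟩
    · exact ⟨none, rfl⟩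
    · exact ⟨some (⟨q', hS.2 h q.2⟩, s), rfl⟩
  choose M' hM' using h
  let _ : Inhabited S := ⟨⟨default, hS.1⟩⟩
  refine ⟨inferInstance, M', fun l => ?_⟩
  have hr : Respects (TM0.step (M' : TM0.Machine Γ S)) (TM0.step M)
      fun c d => (⟨c.q.1, c.Tape⟩ : TM0.Cfg Γ Λ) = d := by
    rw [fun_respects]
    rintro ⟨q, T⟩
    have := hM' q T.1
    rcases e : M' q T.1 with _ | ⟨q', s⟩
    · rw [e] at this
      simp only [TM0.step, e, Option.map_none, FRespects]
      rw [← this]; rfl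
    · rw [e] at this
      simp only [TM0.step, e, Option.map_some, FRespects]
      refine Relation.TransGen.single ?_
      change Option.map _ (M q.1 T.1) = _
      rw [← this]; rfl
  exact (tr_eval_dom hr (a₁ := TM0.init l) rfl).symm

/-- Multi-stack machines are simulated by finite machines. -/
theorem exists_machine_of_stackMachine {K Λ σ : Type} {Γ : K → Type} [DecidableEq K] [Inhabited Λ]
    [Inhabited σ] [Fintype σ] (M : Λ → TM2.Stmt Γ Λ σ) {S : Finset Λ} (hS : TM2.Supports M S)
    (k : K) :
    ∃ (Λ' : Type) (_ : Inhabited Λ') (_ : Finite Λ') (M' : TM0.Machine (TM2to1.Γ' K Γ) Λ'),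
      ∀ L, (TM0.eval M' (TM2to1.trInit k L)).Dom ↔ (TM2.eval M k L).Dom := by
  obtain ⟨hi, M', hM'⟩ :=
    exists_restrict _ (TM1to0.tr_supports _ (TM2to1.tr_supports M hS))
  refine ⟨_, hi, Finset.finite_toSet _, M', fun L => ?_⟩
  rw [hM', TM1to0.tr_eval, TM2to1.tr_eval_dom]

/-- A partial recursive function that has the value `f k` at `2 ^ k`. -/
theorem exists_partrec_two_pow {f : ℕ →. ℕ} (hf : Partrec f) :
    ∃ g : ℕ →. ℕ, Partrec g ∧ ∀ k, g (2 ^ k) = f k := by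
  have hp : Primrec fun k => 2 ^ k := by
    refine (Primrec.nat_iterate .id (.const 1) (h := fun _ x => 2 * x)
      (Primrec.nat_mul.comp (.const 2) .snd)).of_eq fun k => ?_
    induction k with
    | zero => rfl
    | succ k ih =>
      rw [id] at ih ⊢
      rw [Function.iterate_succ_apply', ih]; ring
  let g : ℕ →. ℕ := fun x => (Nat.rfind fun k => Part.some (decide (2 ^ k = x))).bind f
  have hg : Partrec g := by
    refine Partrec.bind (Partrec.rfind ?_) (hf.comp Computable.snd)
    exact (Primrec.to_comp (PrimrecPred.decide (Primrec.eq.comp (hp.comp .snd) .fst))).partrec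
  refine ⟨g, hg, fun k => ?_⟩
  have : k ∈ Nat.rfind (PFun.lift fun k' => decide (2 ^ k' = 2 ^ k)) := by
    refine Nat.mem_rfind.2 ⟨?_, fun {j} hj => ?_⟩
    · simp [PFun.lift]
    · have : 2 ^ j ≠ 2 ^ k := (Nat.pow_lt_pow_right (by decide) hj).ne
      simp [PFun.lift, this]
  have h := Part.eq_some_iff.2 this
  exact (congrArg (fun p => Part.bind p f) h).trans (Part.bind_some k f)

/-- The domain of every partial recursive function is accepted by a finite machine. -/
theorem exists_machine_of_partrec {f : ℕ →. ℕ} (hf : Partrec f) :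
    ∃ (Γ Λ : Type) (_ : Inhabited Γ) (_ : Inhabited Λ) (_ : Finite Γ) (_ : Finite Λ)
      (M : TM0.Machine Γ Λ) (a b c : Γ),
      ∀ k, (TM0.eval M (a :: b :: List.replicate k c)).Dom ↔ (f k).Dom := by
  obtain ⟨g, hg, hgk⟩ := exists_partrec_two_pow hf
  obtain ⟨c, hc⟩ := ToPartrec.Code.exists_code (Nat.Partrec'.part_iff₁.2 hg)
  let _ : Inhabited PartrecToTM2.Λ' := ⟨PartrecToTM2.trNormal c .halt⟩
  obtain ⟨Λ', hi, hfin, M, hM⟩ :=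
    exists_machine_of_stackMachine _ (PartrecToTM2.tr_supports c .halt) PartrecToTM2.K'.main
  let sym : PartrecToTM2.Γ' → TM2to1.Γ' PartrecToTM2.K' fun _ => PartrecToTM2.Γ' :=
    fun a => (false, Function.update (fun _ => none) .main (some a))
  refine ⟨_, _, inferInstance, hi, inferInstance, hfin, M,
    (true, (sym .cons).2), sym .bit1, sym .bit0, fun k => ?_⟩
  have hin : TM2to1.trInit (Γ := fun _ => PartrecToTM2.Γ') PartrecToTM2.K'.main
      (PartrecToTM2.trList [2 ^ k]) =
      (true, (sym .cons).2) :: sym .bit1 :: List.replicate k (sym .bit0) := by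
    have hL : (PartrecToTM2.trList [2 ^ k]).reverse =
        .cons :: .bit1 :: List.replicate k .bit0 := by
      simp [trNat_two_pow]
    rw [TM2to1.trInit, hL, ← List.map_replicate]
    rfl
  have hinit : (TM2.init PartrecToTM2.K'.main (PartrecToTM2.trList [2 ^ k]) :
      PartrecToTM2.Cfg') = PartrecToTM2.init c [2 ^ k] := by
    have : Function.update (fun _ => []) PartrecToTM2.K'.main (PartrecToTM2.trList [2 ^ k]) =
        PartrecToTM2.K'.elim (PartrecToTM2.trList [2 ^ k]) [] [] [] := by
      funext k
      cases k <;> rfl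
    exact congrArg (TM2.Cfg.mk _ _) this
  have heval := PartrecToTM2.tr_eval c [2 ^ k]
  rw [hc ⟨[2 ^ k], rfl⟩, ← hinit] at heval
  refine (iff_of_eq (congrArg (fun l => (TM0.eval M l).Dom) hin.symm)).trans
    ((hM _).trans ((iff_of_eq (congrArg Part.Dom heval)).trans ?_))
  rw [← hgk k]
  rfl

namespace TM

theorem halts_iff_eval_dom {Q A : Type} (M : TM Q A) : M.Halts ↔ (eval M.step M.init).Dom := by
  rw [Part.dom_iff_mem]
  exact exists_congr fun c => (mem_eval (f := M.step)).symm

theorem step_right {Q A : Type} {M : TM Q A} {s q : Q} {h : ℕ} {t : ℕ → A} {b : A}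
    (e : M.δ s (t h) = some (q, b, .right)) :
    M.step ⟨s, h, t⟩ = some ⟨q, h + 1, Function.update t h b⟩ := by
  simp only [step, e]

theorem step_left {Q A : Type} {M : TM Q A} {s q : Q} {h : ℕ} {t : ℕ → A} {b : A}
    (e : M.δ s (t (h + 1)) = some (q, b, .left)) :
    M.step ⟨s, h + 1, t⟩ = some ⟨q, h, Function.update t (h + 1) b⟩ := by
  simp only [step, e]

theorem step_none {Q A : Type} {M : TM Q A} {s : Q} {h : ℕ} {t : ℕ → A}
    (e : M.δ s (t h) = none) : M.step ⟨s, h, t⟩ = none := by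
  simp only [step, e]

/-- Renaming of states and symbols. -/
def transport {Q A Q₂ A₂ : Type} (M : TM Q A) (eQ : Q ≃ Q₂) (eA : A ≃ A₂) : TM Q₂ A₂ where
  start := eQ M.start
  blank := eA M.blank
  δ q a := (M.δ (eQ.symm q) (eA.symm a)).map fun t => (eQ t.1, eA t.2.1, t.2.2)

theorem transport_halts_iff {Q A Q₂ A₂ : Type} (M : TM Q A) (eQ : Q ≃ Q₂) (eA : A ≃ A₂) :
    (M.transport eQ eA).Halts ↔ M.Halts := by
  have hr : Respects M.step (M.transport eQ eA).step
      fun c d => (⟨eQ c.state, c.head, eA ∘ c.tape⟩ : Cfg Q₂ A₂) = d := by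
    rw [fun_respects]
    rintro ⟨s, h, t⟩
    have hδ : (M.transport eQ eA).δ (eQ s) ((eA ∘ t) h) =
        (M.δ s (t h)).map fun t => (eQ t.1, eA t.2.1, t.2.2) := by
      simp [transport]
    rcases e : M.δ s (t h) with _ | ⟨q, b, _ | _⟩ <;> rw [e] at hδ
    · rw [step_none e]
      exact step_none hδ
    · rcases h with _ | h
      · have e1 : M.step ⟨s, 0, t⟩ = none := by simp only [step, e]
        rw [e1]
        simp only [FRespects, step, hδ, Option.map_some]
      · rw [step_left e]
        refine Relation.TransGen.single ((step_left hδ).trans ?_)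
        simp only [Function.comp_update]
    · rw [step_right e]
      refine Relation.TransGen.single ((step_right hδ).trans ?_)
      simp only [Function.comp_update]
  rw [halts_iff_eval_dom, halts_iff_eval_dom]
  exact tr_eval_dom hr (a₁ := M.init) rfl

end TM

namespace Fold

variable {Γ Λ : Type} [Inhabited Γ] [Inhabited Λ]

/-- States of the simulation of a two-sided tape: `none` is the state that moves the head back to
the left end; `some (q, side, back)` simulates the state `q`, where `side` tells whether the head is
on the right half of the folded tape, and `back` whether a step to the left is due. -/
abbrev State (Λ : Type) : Type := Option (Λ × Bool × Bool)

/-- Tape symbols of the simulation: the marker `none` in the leftmost cell, and pairs of symbols of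
the right and the left half of the folded tape. -/
abbrev Sym (Γ : Type) : Type := Option (Γ × Γ)

/-- The directions of the left half of the tape are reversed. -/
def turn (side : Bool) : Dir → Dir
  | .left => if side then .left else .right
  | .right => if side then .right else .left

/-- Transitions of the simulation. -/
def trans (M : TM0.Machine Γ Λ) : State Λ → Sym Γ → Option (State Λ × Sym Γ × Dir)
  | none, none => some (some (default, true, false), none, .right)
  | none, some p => some (none, some p, .left)
  | some (q, side, true), x => some (some (q, side, false), x, .left)
  | some (q, side, false), none => some (some (q, !side, false), none, .right)
  | some (q, side, false), some p =>
    match M q (if side then p.1 else p.2) with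
    | none => none
    | some (q', .move d) => some (some (q', side, false), some p, turn side d)
    | some (q', .write c) =>
      some (some (q', side, true), some (if side then (c, p.2) else (p.1, c)), .right)

/-- The folded tape with the input `l`. -/
def input (l : List Γ) : ℕ → Sym Γ
  | 0 => none
  | i + 1 => some (l.getI i, default)

/-- The machine that writes the input `l` on the tape and then simulates `M`. -/
def machine (M : TM0.Machine Γ Λ) (l : List Γ) :
    TM (State Λ ⊕ Fin (l.length + 1)) (Sym Γ) where
  start := .inr 0
  blank := some (default, default)
  δ
    | .inl s, x => (trans M s x).map fun t => (.inl t.1, t.2)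
    | .inr i, _ => some (if h : i.val + 1 < l.length + 1 then .inr ⟨i + 1, h⟩ else .inl none,
        input l i, .right)

variable {M : TM0.Machine Γ Λ} {l : List Γ}

theorem input_of_lt {i : ℕ} (h : l.length < i) : input l i = some (default, default) := by
  obtain ⟨i, rfl⟩ : ∃ j, i = j + 1 := ⟨i - 1, by omega⟩
  rw [input, List.getI_eq_default _ (by omega)]

theorem reaches_write (i : ℕ) (hi : i < l.length + 1) :
    Reaches (machine M l).step (machine M l).init
      ⟨.inr ⟨i, hi⟩, i, fun j => if j < i then input l j else some (default, default)⟩ := by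
  induction i with
  | zero => exact .refl
  | succ i ih =>
    refine (ih (by omega)).tail ?_
    refine (TM.step_right (q := .inr ⟨i + 1, hi⟩) (b := input l i) ?_).trans ?_
    · simp only [machine]
      rw [dif_pos hi]
    · congr 2
      funext j
      rw [Function.update_apply]
      split_ifs <;> first | rfl | omega | skip
      next h _ => rw [h]

theorem reaches_written :
    Reaches (machine M l).step (machine M l).init ⟨.inl none, l.length + 1, input l⟩ := by
  refine (reaches_write l.length (by omega)).tail ?_
  refine (TM.step_right (q := .inl none) (b := input l l.length) ?_).trans ?_
  · simp only [machine]
    rw [dif_neg (by omega)]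
  · congr 2
    funext j
    rw [Function.update_apply]
    split_ifs with h1 h2
    · rw [h1]
    · rfl
    · exact (input_of_lt (by omega)).symm

theorem reaches_rewind (i : ℕ) :
    Reaches (machine M l).step ⟨.inl none, i, input l⟩
      ⟨.inl (some (default, true, false)), 1, input l⟩ := by
  induction i with
  | zero =>
    refine Relation.ReflTransGen.single ((TM.step_right (b := none) rfl).trans ?_)
    congr 2
    exact Function.update_eq_self 0 (input l)
  | succ i ih =>
    refine ih.head ((TM.step_left (b := input l (i + 1)) rfl).trans ?_)
    congr 2
    exact Function.update_eq_self (i + 1) (input l)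

/-- The folded tape `t` represents the two-sided tape `T` whose head is at position `p`. -/
structure IsFold (T : Tape Γ) (p : ℤ) (t : ℕ → Sym Γ) : Prop where
  zero : t 0 = none
  succ : ∀ i : ℕ, t (i + 1) = some (T.nth (i - p), T.nth (-i - 1 - p))

theorem IsFold.move_right {T : Tape Γ} {p : ℤ} {t : ℕ → Sym Γ} (h : IsFold T p t) :
    IsFold (T.move .right) (p + 1) t := by
  refine ⟨h.zero, fun i => ?_⟩
  rw [h.succ, Tape.move_right_nth, Tape.move_right_nth]
  congr 3 <;> ring

theorem IsFold.move_left {T : Tape Γ} {p : ℤ} {t : ℕ → Sym Γ} (h : IsFold T p t) :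
    IsFold (T.move .left) (p - 1) t := by
  refine ⟨h.zero, fun i => ?_⟩
  rw [h.succ, Tape.move_left_nth, Tape.move_left_nth]
  congr 3 <;> ring

/-- The position of the head on the two-sided tape, if it is in cell `j + 1` of the folded tape. -/
def pos (side : Bool) (j : ℕ) : ℤ := if side then j else -j - 1

theorem IsFold.write {T : Tape Γ} {side : Bool} {j : ℕ} {t : ℕ → Sym Γ} {u : Γ × Γ}
    (h : IsFold T (pos side j) t) (hu : t (j + 1) = some u) (c : Γ) :
    IsFold (T.write c) (pos side j)
      (Function.update t (j + 1) (some (if side then (c, u.2) else (u.1, c)))) := by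
  refine ⟨by rw [Function.update_of_ne (by omega), h.zero], fun i => ?_⟩
  rw [Tape.write_nth, Tape.write_nth, Function.update_apply]
  rw [h.succ] at hu
  obtain rfl := Option.some.inj hu
  by_cases hij : i = j
  · subst hij
    rw [if_pos rfl]
    cases side
    · simp only [pos, Bool.false_eq_true, if_false]
      rw [if_neg (by omega), if_pos (by omega)]
    · simp only [pos, if_true]
      rw [if_pos (by omega), if_neg (by omega)]
  · rw [if_neg (by omega), h.succ]
    cases side
    · simp only [pos, Bool.false_eq_true, if_false]
      rw [if_neg (by omega), if_neg (by omega)]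
    · simp only [pos, if_true]
      rw [if_neg (by omega), if_neg (by omega)]

theorem IsFold.read {T : Tape Γ} {side : Bool} {j : ℕ} {t : ℕ → Sym Γ}
    (h : IsFold T (pos side j) t) :
    ∃ u, t (j + 1) = some u ∧ (if side then u.1 else u.2) = T.head := by
  refine ⟨_, h.succ j, ?_⟩
  cases side <;> simp [pos]

/-- The configuration `d` of the simulation represents the configuration `c`. -/
def Represents (l : List Γ) (c : TM0.Cfg Γ Λ)
    (d : TM.Cfg (State Λ ⊕ Fin (l.length + 1)) (Sym Γ)) : Prop :=
  ∃ side j t, IsFold c.Tape (pos side j) t ∧ d = ⟨.inl (some (c.q, side, false)), j + 1, t⟩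

theorem represents_init :
    Represents l (TM0.init l : TM0.Cfg Γ Λ) ⟨.inl (some (default, true, false)), 1, input l⟩ := by
  refine ⟨true, 0, input l, ⟨rfl, fun i => ?_⟩, rfl⟩
  have h1 : (TM0.init l : TM0.Cfg Γ Λ).Tape.nth (i - pos true 0) = l.getI i := by
    simp only [pos, TM0.init, Tape.mk₁, Tape.mk₂, if_true, Nat.cast_zero, sub_zero]
    rw [Tape.mk'_nth_nat, ListBlank.nth_mk]
  have h2 : (TM0.init l : TM0.Cfg Γ Λ).Tape.nth (-i - 1 - pos true 0) = default := by
    have : -(i : ℤ) - 1 - pos true 0 = Int.negSucc i := by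
      simp only [pos, if_true, Nat.cast_zero, Int.negSucc_eq]; ring
    rw [this]
    change (ListBlank.mk []).nth i = default
    rw [ListBlank.nth_mk]
    cases i <;> rfl
  rw [h1, h2, input]

/-- A step of the simulation that moves the head and does not change the tape. -/
theorem reaches_move {q : Λ} {side : Bool} {j : ℕ} {t : ℕ → Sym Γ} {T : Tape Γ} {q' : Λ} {d : Dir}
    (h : IsFold T (pos side j) t) (hM : M q T.head = some (q', .move d)) :
    ∃ b, Represents l ⟨q', T.move d⟩ b ∧
      Reaches₁ (machine M l).step ⟨.inl (some (q, side, false)), j + 1, t⟩ b := by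
  obtain ⟨u, hu, hhead⟩ := h.read
  have hδ : (machine M l).δ (.inl (some (q, side, false))) (t (j + 1)) =
      some (.inl (some (q', side, false)), t (j + 1), turn side d) := by
    simp [machine, trans, hu, hhead, hM]
  have h0 : ∀ s, (machine M l).δ (.inl (some (q', s, false))) (t 0) =
      some (.inl (some (q', !s, false)), t 0, .right) := by
    intro s
    simp [machine, trans, h.zero]
  have hself : ∀ i, Function.update t i (t i) = t := fun i => Function.update_eq_self i t
  have hout : turn side d = .right → ∃ b, Represents l ⟨q', T.move d⟩ b ∧
      Reaches₁ (machine M l).step ⟨.inl (some (q, side, false)), j + 1, t⟩ b := by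
    intro hd
    rw [hd] at hδ
    refine ⟨⟨.inl (some (q', side, false)), j + 2, t⟩, ⟨side, j + 1, t, ?_, rfl⟩,
      Relation.TransGen.single ((TM.step_right hδ).trans (by rw [hself]))⟩
    cases side <;> cases d <;> simp only [turn, if_true, Bool.false_eq_true, if_false,
      reduceCtorEq] at hd
    · convert h.move_left using 1
      simp [pos]; ring
    · convert h.move_right using 1
      simp [pos]
  have hin : turn side d = .left → ∃ b, Represents l ⟨q', T.move d⟩ b ∧
      Reaches₁ (machine M l).step ⟨.inl (some (q, side, false)), j + 1, t⟩ b := by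
    intro hd
    rw [hd] at hδ
    have h1 : (machine M l).step ⟨.inl (some (q, side, false)), j + 1, t⟩ =
      some ⟨.inl (some (q', side, false)), j, t⟩ := (TM.step_left hδ).trans (by rw [hself])
    rcases j with _ | j
    · refine ⟨⟨.inl (some (q', !side, false)), 1, t⟩, ⟨!side, 0, t, ?_, rfl⟩,
        Relation.TransGen.head h1 (Relation.TransGen.single
          ((TM.step_right (h0 side)).trans (by rw [hself])))⟩
      cases side <;> cases d <;> simp only [turn, if_true, Bool.false_eq_true, if_false,
        reduceCtorEq] at hd
      · convert h.move_right using 1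
        simp [pos]
      · convert h.move_left using 1
        simp [pos]
    · refine ⟨⟨.inl (some (q', side, false)), j + 1, t⟩, ⟨side, j, t, ?_, rfl⟩,
        Relation.TransGen.single h1⟩
      cases side <;> cases d <;> simp only [turn, if_true, Bool.false_eq_true, if_false,
        reduceCtorEq] at hd
      · convert h.move_right using 1
        simp [pos]; ring
      · convert h.move_left using 1
        simp [pos]
  rcases hd : turn side d with _ | _
  · exact hin hd
  · exact hout hd

theorem reaches_write_sym {q : Λ} {side : Bool} {j : ℕ} {t : ℕ → Sym Γ} {T : Tape Γ} {q' : Λ}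
    {c : Γ} (h : IsFold T (pos side j) t) (hM : M q T.head = some (q', .write c)) :
    ∃ b, Represents l ⟨q', T.write c⟩ b ∧
      Reaches₁ (machine M l).step ⟨.inl (some (q, side, false)), j + 1, t⟩ b := by
  obtain ⟨u, hu, hhead⟩ := h.read
  have hδ : (machine M l).δ (.inl (some (q, side, false))) (t (j + 1)) =
      some (.inl (some (q', side, true)),
        some (if side then (c, u.2) else (u.1, c)), .right) := by
    simp [machine, trans, hu, hhead, hM]
  refine ⟨_, ⟨side, j, _, h.write hu c, rfl⟩, Relation.TransGen.head (TM.step_right hδ)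
    (Relation.TransGen.single ((TM.step_left rfl).trans ?_))⟩
  rw [Function.update_eq_self]

theorem respects : Respects (TM0.step M) (machine M l).step (Represents l) := by
  rintro ⟨q, T⟩ _ ⟨side, j, t, h, rfl⟩
  rcases e : M q T.head with _ | ⟨q', d | c⟩
  · have e1 : TM0.step M ⟨q, T⟩ = none := by simp only [TM0.step, e, Option.map_none]
    rw [e1]
    obtain ⟨u, hu, hhead⟩ := h.read
    exact TM.step_none (by simp [machine, trans, hu, hhead, e])
  · have e1 : TM0.step M ⟨q, T⟩ = some ⟨q', T.move d⟩ := by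
      simp only [TM0.step, e, Option.map_some]
    rw [e1]
    exact reaches_move h e
  · have e1 : TM0.step M ⟨q, T⟩ = some ⟨q', T.write c⟩ := by
      simp only [TM0.step, e, Option.map_some]
    rw [e1]
    exact reaches_write_sym h e

/-- The simulation halts on the empty word if and only if the machine halts on its input. -/
theorem machine_halts_iff : (machine M l).Halts ↔ (TM0.eval M l).Dom := by
  rw [TM.halts_iff_eval_dom, reaches_eval (reaches_written.trans (reaches_rewind _))]
  exact tr_eval_dom respects represents_init

end Fold

namespace Fold

variable {Γ Λ : Type} [Inhabited Γ] [Inhabited Λ] {N m : ℕ}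

/-- The simulation with numbers as states and symbols. -/
def numMachine (M : TM0.Machine Γ Λ) (eQ : State Λ ≃ Fin N) (eA : Sym Γ ≃ Fin m) (l : List Γ) :
    TM (Fin (N + (l.length + 1))) (Fin m) :=
  (machine M l).transport ((Equiv.sumCongr eQ (Equiv.refl _)).trans finSumFinEquiv) eA

theorem numMachine_δ_castAdd (M : TM0.Machine Γ Λ) (eQ : State Λ ≃ Fin N) (eA : Sym Γ ≃ Fin m)
    (l : List Γ) (q : Fin N) (a : Fin m) :
    (numMachine M eQ eA l).δ (Fin.castAdd _ q) a = (trans M (eQ.symm q) (eA.symm a)).map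
      fun t => (Fin.castAdd _ (eQ t.1), eA t.2.1, t.2.2) := by
  have h : ((Equiv.sumCongr eQ (Equiv.refl _)).trans finSumFinEquiv).symm
      (Fin.castAdd (l.length + 1) q) = .inl (eQ.symm q) := by
    rw [Equiv.symm_apply_eq]
    simp
  simp only [numMachine, TM.transport]
  rw [h]
  simp only [machine, Option.map_map]
  refine congrArg (fun f => Option.map f _) (funext fun t => ?_)
  simp

theorem numMachine_δ_natAdd (M : TM0.Machine Γ Λ) (eQ : State Λ ≃ Fin N) (eA : Sym Γ ≃ Fin m)
    (l : List Γ) (i : Fin (l.length + 1)) (a : Fin m) :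
    (numMachine M eQ eA l).δ (Fin.natAdd N i) a =
      some (if h : i.val + 1 < l.length + 1 then Fin.natAdd N ⟨i + 1, h⟩
        else Fin.castAdd _ (eQ none), eA (input l i), .right) := by
  have h : ((Equiv.sumCongr eQ (Equiv.refl _)).trans finSumFinEquiv).symm
      (Fin.natAdd N i) = .inr i := by
    rw [Equiv.symm_apply_eq]
    simp
  simp only [numMachine, TM.transport]
  rw [h]
  simp only [machine, Option.map_some]
  split_ifs <;> simp

/-- The part of the table that does not depend on the input. -/
def table (M : TM0.Machine Γ Λ) (eQ : State Λ ≃ Fin N) (eA : Sym Γ ≃ Fin m) :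
    List (List (Option (ℕ × ℕ × Bool))) :=
  List.ofFn fun q => List.ofFn fun a => (trans M (eQ.symm q) (eA.symm a)).map fun t =>
    ((eQ t.1).val, (eA t.2.1).val, TM.dirBool t.2.2)

theorem code_numMachine (M : TM0.Machine Γ Λ) (eQ : State Λ ≃ Fin N) (eA : Sym Γ ≃ Fin m)
    (l : List Γ) :
    (numMachine M eQ eA l).code = ((N + (l.length + 1), m), N, (eA (some (default, default))).val,
      table M eQ eA ++ (List.range (l.length + 1)).map fun i => (List.range m).map fun _ =>
        some (if i + 1 < l.length + 1 then N + (i + 1) else (eQ none).val,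
          (eA (input l i)).val, true)) := by
  unfold TM.code
  refine congrArg₂ Prod.mk rfl (congrArg₂ Prod.mk ?_ (congrArg₂ Prod.mk rfl ?_))
  · simp [numMachine, TM.transport, machine]
  · rw [List.ofFn_add]
    refine congrArg₂ (· ++ ·) ?_ ?_
    · unfold table
      refine congrArg List.ofFn (funext fun q => congrArg List.ofFn (funext fun a => ?_))
      refine (congrArg (Option.map _) (numMachine_δ_castAdd M eQ eA l q a)).trans ?_
      rcases trans M (eQ.symm q) (eA.symm a) with _ | ⟨s, b, _ | _⟩ <;> rfl
    · refine TilingGame.ofFn_eq_map_range fun i => TilingGame.ofFn_eq_map_range fun a => ?_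
      rw [numMachine_δ_natAdd]
      split_ifs <;> rfl

theorem input_cons_cons_replicate {a b c : Γ} {k i : ℕ} (h : i < k + 3) :
    input (a :: b :: List.replicate k c) i = if i = 0 then none else if i = 1 then some (a, default)
      else if i = 2 then some (b, default) else some (c, default) := by
  rcases i with _ | _ | _ | i
  · rfl
  · rfl
  · rfl
  · rw [if_neg (by omega), if_neg (by omega), if_neg (by omega), input,
      List.getI_eq_getElem _ (by simp; omega)]
    simp

end Fold

/-- The domain of a partial recursive function is reduced to the halting problem. -/
theorem exists_reduction_to_halts {f : ℕ →. ℕ} (hf : Partrec f) :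
    ∃ r : ℕ → TM.Code, Computable r ∧
      ∀ k, ∃ (n m : ℕ) (M : TM (Fin n) (Fin m)), r k = M.code ∧ (M.Halts ↔ (f k).Dom) := by
  obtain ⟨Γ, Λ, _, _, _, _, M, a, b, c, hM⟩ := exists_machine_of_partrec hf
  let eQ := Finite.equivFin (Fold.State Λ)
  let eA := Finite.equivFin (Fold.Sym Γ)
  let l : ℕ → List Γ := fun k => a :: b :: List.replicate k c
  have hl : ∀ k, (l k).length + 1 = k + 3 := fun k => by simp [l]
  refine ⟨fun k => (Fold.numMachine M eQ eA (l k)).code, ?_, fun k => ⟨_, _, _, rfl, ?_⟩⟩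
  · have hp : Primrec fun k => ((Nat.card (Fold.State Λ) + (k + 3), Nat.card (Fold.Sym Γ)),
        Nat.card (Fold.State Λ), (eA (some (default, default))).val,
        Fold.table M eQ eA ++ (List.range (k + 3)).map fun i =>
          (List.range (Nat.card (Fold.Sym Γ))).map fun _ =>
            some (if i + 1 < k + 3 then Nat.card (Fold.State Λ) + (i + 1) else (eQ none).val,
              if i = 0 then (eA none).val else if i = 1 then (eA (some (a, default))).val else
              if i = 2 then (eA (some (b, default))).val else (eA (some (c, default))).val,
              true)) := by
      have h3 : Primrec fun k => k + 3 := Primrec.nat_add.comp .id (.const 3)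
      refine Primrec.pair (Primrec.pair (Primrec.nat_add.comp (.const _) h3) (.const _))
        (Primrec.pair (.const _) (Primrec.pair (.const _) (Primrec.list_append.comp (.const _)
          (Primrec.list_map (Primrec.list_range.comp h3) (Primrec.list_map (.const _)
            (Primrec.option_some.comp ?_))))))
      have hi : Primrec fun y : (ℕ × ℕ) × ℕ => y.1.2 := Primrec.snd.comp .fst
      have hi1 : Primrec fun y : (ℕ × ℕ) × ℕ => y.1.2 + 1 := Primrec.succ.comp hi
      refine Primrec.pair (Primrec.ite (Primrec.nat_lt.comp hi1 (h3.comp (Primrec.fst.comp .fst)))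
        (Primrec.nat_add.comp (.const _) hi1) (.const _)) (Primrec.pair ?_ (.const true))
      exact Primrec.ite (Primrec.eq.comp hi (.const 0)) (.const _)
        (Primrec.ite (Primrec.eq.comp hi (.const 1)) (.const _)
          (Primrec.ite (Primrec.eq.comp hi (.const 2)) (.const _) (.const _)))
    refine hp.to_comp.of_eq fun k => ?_
    rw [Fold.code_numMachine, hl]
    refine congrArg (fun t => (_, _, _, _ ++ t)) (List.map_congr_left fun i hi => ?_)
    rw [Fold.input_cons_cons_replicate (List.mem_range.1 hi)]
    simp only [apply_ite eA, apply_ite Fin.val]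
  · rw [← hM, Fold.numMachine, TM.transport_halts_iff, Fold.machine_halts_iff]

theorem not_modelCheckingDecidable : ¬ ModelCheckingDecidable := by
  rintro ⟨f, hf, hfI⟩
  obtain ⟨r, hr, hrk⟩ := exists_reduction_to_halts
    (f := fun k => (Denumerable.ofNat Nat.Partrec.Code k).eval 0)
    (Nat.Partrec.Code.eval_part.comp (Computable.ofNat _) (Computable.const 0))
  have key : ∀ k, f (reduction (r k)) = true ↔
      ¬ ((Denumerable.ofNat Nat.Partrec.Code k).eval 0).Dom := by
    intro k
    obtain ⟨n, m, M, hrM, hM⟩ := hrk k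
    obtain ⟨S, P, Act, hS, hP, hAct, G, s, ok, hc, hG⟩ := reduction_correct M
    rw [← hM, hG, hrM, hc]
    exact hfI _
  refine ComputablePred.halting_problem 0 ?_
  have hd : ComputablePred fun c : Nat.Partrec.Code =>
      ¬ f (reduction (r (Encodable.encode c))) = true := by
    refine ComputablePred.not ?_
    refine ComputablePred.computable_iff.2 ⟨_, hf.comp (primrec_reduction.to_comp.comp
      (hr.comp Computable.encode)), rfl⟩
  refine hd.of_eq fun c => ?_
  rw [key, Denumerable.ofNat_encode, not_not]

end ATLiR

theorem mainTheorem1 :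
    ¬ ATLiR.ModelCheckingDecidable ∧
    ∃ r : ATLiR.TM.Code → ATLiR.InstanceCode, Computable r ∧
      ∀ (n m : ℕ) (M : ATLiR.TM (Fin n) (Fin m)),
        ∃ (S P Act : ℕ) (hS : 0 < S) (hP : 0 < P) (hAct : 0 < Act)
          (G : ATLiR.CGS (Fin 3) (Fin S) (Fin P) (Fin Act)) (sInit : Fin S) (ok : Fin P),
          r M.code = ATLiR.Instance.code
            { numAgents := 3, numStates := S, numProps := P, numActs := Act
              agents_pos := by decide
              states_pos := hS, props_pos := hP, acts_pos := hAct
              G := G, state := sInit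
              formula := .globally {0, 1} (by simp) (.atom ok) } ∧
          (¬ M.Halts ↔ G.Sat sInit (.globally {0, 1} (by simp) (.atom ok))) :=
  ⟨ATLiR.not_modelCheckingDecidable, ATLiR.reduction, ATLiR.primrec_reduction.to_comp,
    fun _ _ M => ATLiR.reduction_correct M⟩
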